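/- **Parallel Transportation Theorem.** Let $M$ be a smooth $N$-dimensional manifold with a smooth Riemannian metric $a_{ij}$ and a smooth 1-form $b=b_iy^i$ of unit norm, $a_{ij}b^ib^j=1$ where $b^i=a^{ij}b_j$, and let $g\in(-2,2)$ be a constant. Put $h=\sqrt{1-g^2/4}$, $r_{ij}=a_{ij}-b_ib_j$ and, for $y\in T_xM$, $$q=\sqrt{r_{ij}y^iy^j},\quad A=b+\tfrac12 gq,\quad B=b^2+gbq+q^2,\quad K=\sqrt B\,\exp\Bigl(-\frac{g}{2h}\arccos\frac{A}{\sqrt B}\Bigr).$$ $K=K(x,y)$ is the Finsleroid–Finsler metric function. Let $g_{ij}=\frac12\,\partial^2K^2/\partial y^i\partial y^j$, let $\gamma^i{}_{mn}(x,y)$ be the Christoffel symbols of $g_{ij}(x,y)$ (derivatives taken with respect to $x$), and let $G^i=\gamma^i{}_{mn}y^my^n$ and $\bar G^i{}_k=\frac12\,\partial G^i/\partial y^k$. For $y_1,y_2\in T_xM$, with subscripts $1,2$ marking values at $y_1,y_2$, let $$\lambda=\frac{A_1A_2+h^2r_{ij}y_1^iy_2^j}{\sqrt{B_1}\sqrt{B_2}},\qquad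 \alpha=\frac1h\arccos\lambda,\qquad \langle y_1,y_2\rangle_x=K_1K_2\cos\alpha .$$ Assume the Landsberg case: there is a scalar function $k$ on $M$ with $\nabla_ib_j=k\,(a_{ij}-b_ib_j)$, where $\nabla$ is the Levi-Civita derivative of $a_{ij}$. Then: 1. In any local coordinates, at every $(x,y_1,y_2)$ with $q_1>0$, $q_2>0$ (that is, $y_1,y_2$ are not collinear with $b^i$) and $\lambda\neq-1$, the function $\langle y_1,y_2\rangle_x$ is differentiable in $(x,y_1,y_2)$, and for every $k=1,\dots,N$ (here $k$ is a coordinate index) $$\frac{\partial\langle y_1,y_2\rangle_x}{\partial x^k}-\bar G^n{}_k(x,y_1)\frac{\partial\langle y_1,y_2\rangle_x}{\partial y_1^n}-\bar G^n{}_k(x,y_2)\frac{\partial\langle y_1,y_2\rangle_x}{\partial y_2^n}=0 .$$ 2. Let $y_1(t),y_2(t)$ be vector fields along a differentiable curve $x(t)$ in $M$, $t$ in an interval, that are parallel, $\delta y_a^i=dy_a^i+\bar G^i{}_k(x,y_a)\,dx^k=0$ for $a=1,2$, and have $q_1>0$, $q_2>0$ throughout. Then the following are constant along the curve: the scalar product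 $\langle y_1,y_2\rangle_x$, the angle $\alpha$, and the absolute angle $\arccos\bigl(\langle y_1,y_2\rangle_x/(\|y_1\|_x\|y_2\|_x)\bigr)$, where $\|y\|_x=\sqrt{g_{ij}(x,y)y^iy^j}$. -/

import Mathlib

open scoped Manifold ContDiff

noncomputable section

/-- The coordinate space `ℝ^N`. -/
abbrev RSpace (N : ℕ) : Type := EuclideanSpace ℝ (Fin N)

/-- The `i`-th partial derivative of a function on `ℝ^N`. -/
def partialDeriv {N : ℕ} (i : Fin N) (f : RSpace N → ℝ) (x : RSpace N) : ℝ :=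
  fderiv ℝ f x (EuclideanSpace.single i 1)

/-- Christoffel symbols of the second kind of a field of symmetric matrices `m_ij(x)`:
`Γ^i_jk = ½ m^{il} (∂_j m_lk + ∂_k m_lj - ∂_l m_jk)`. -/
def christoffel {N : ℕ} (m : RSpace N → Matrix (Fin N) (Fin N) ℝ) (x : RSpace N)
    (i j k : Fin N) : ℝ :=
  (1 / 2) * ∑ l, (m x)⁻¹ i l *
    (partialDeriv j (fun u => m u l k) x + partialDeriv k (fun u => m u l j) x
      - partialDeriv l (fun u => m u j k) x)

namespace Finsler

/-! General Finsler notions for a metric function `K(x, y)` given in local coordinates. -/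

variable {N : ℕ}

/-- The Finslerian metric tensor `g_ij(x, y) = ½ ∂²K²/∂y^i∂y^j`. -/
def metricTensor (K : RSpace N → RSpace N → ℝ) (x y : RSpace N) : Matrix (Fin N) (Fin N) ℝ :=
  Matrix.of fun i j =>
    (1 / 2) * partialDeriv i (fun w => partialDeriv j (fun v => K x v ^ 2) w) y

/-- The Finslerian Christoffel symbols `γ^i_mn(x, y)`: the Christoffel symbols of `g_ij(x, y)`,
the derivatives being taken in `x` at fixed `y`. -/
def christoffelSymbol (K : RSpace N → RSpace N → ℝ) (x y : RSpace N) (i m n : Fin N) : ℝ :=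
  christoffel (fun u => metricTensor K u y) x i m n

/-- The spray coefficients `G^i(x, y) = γ^i_mn(x, y) y^m y^n`. -/
def spray (K : RSpace N → RSpace N → ℝ) (x y : RSpace N) (i : Fin N) : ℝ :=
  ∑ m, ∑ n, christoffelSymbol K x y i m n * y m * y n

/-- The spray-induced nonlinear connection `Ḡ^i_k(x, y) = ½ ∂G^i/∂y^k`. -/
def connection (K : RSpace N → RSpace N → ℝ) (x y : RSpace N) (i k : Fin N) : ℝ :=
  (1 / 2) * partialDeriv k (fun v => spray K x v i) y

end Finsler

/-- The data of a Finsleroid–Finsler space (positive-definite case) on an `N`-dimensional smooth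
manifold `M`: a smooth Riemannian metric `a`, a smooth 1-form `b` of unit Riemannian norm, and a
constant `g ∈ (-2, 2)`. -/
structure FinsleroidSpace (N : ℕ) (M : Type*) [TopologicalSpace M] [ChartedSpace (RSpace N) M]
    [IsManifold 𝓘(ℝ, RSpace N) ∞ M] where
  /-- The associated Riemannian metric `a_ij`. -/
  a : Bundle.ContMDiffRiemannianMetric 𝓘(ℝ, RSpace N) ∞ (RSpace N)
    (fun p : M => TangentSpace 𝓘(ℝ, RSpace N) p)
  /-- The Finsleroid-axis 1-form `b = b_i y^i`. -/
  b : ∀ p : M, TangentSpace 𝓘(ℝ, RSpace N) p →L[ℝ] ℝ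
  smooth_b : ContMDiff 𝓘(ℝ, RSpace N) (𝓘(ℝ, RSpace N).prod 𝓘(ℝ, RSpace N →L[ℝ] ℝ)) ∞
    (fun p : M => Bundle.TotalSpace.mk' (RSpace N →L[ℝ] ℝ)
      (E := fun p : M => TangentSpace 𝓘(ℝ, RSpace N) p →L[ℝ] Bundle.Trivial M ℝ p) p (b p))
  /-- `a_ij b^i b^j = 1`, where `b^i = a^{ij} b_j` is the vector dual to `b`. -/
  unit_b : ∀ p : M, ∃ w : TangentSpace 𝓘(ℝ, RSpace N) p,
    (∀ v, a.inner p w v = b p v) ∧ a.inner p w w = 1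
  /-- The Finsleroid charge. -/
  g : ℝ
  g_gt : -2 < g
  g_lt : g < 2

namespace FinsleroidSpace

variable {N : ℕ} {M : Type*} [TopologicalSpace M] [ChartedSpace (RSpace N) M]
  [IsManifold 𝓘(ℝ, RSpace N) ∞ M] (F : FinsleroidSpace N M)

/-! ### The Finsleroid functions on a tangent space -/

section Fibre

variable {p : M}

/-- `h = √(1 - g²/4)`. -/
def h : ℝ := √(1 - F.g ^ 2 / 4)

/-- `r_ij y₁^i y₂^j` with `r_ij = a_ij - b_i b_j`. -/
def r (y₁ y₂ : TangentSpace 𝓘(ℝ, RSpace N) p) : ℝ := F.a.inner p y₁ y₂ - F.b p y₁ * F.b p y₂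

/-- `q = √(r_ij y^i y^j)`. -/
def q (y : TangentSpace 𝓘(ℝ, RSpace N) p) : ℝ := √(F.r y y)

/-- `A = b + g q / 2`. -/
def A (y : TangentSpace 𝓘(ℝ, RSpace N) p) : ℝ := F.b p y + F.g / 2 * F.q y

/-- The Finsleroid characteristic quadratic form `B = b² + g b q + q²` (equal to `A² + h² q²`). -/
def B (y : TangentSpace 𝓘(ℝ, RSpace N) p) : ℝ :=
  F.b p y ^ 2 + F.g * F.b p y * F.q y + F.q y ^ 2

/-- `χ = (1/h) arccos (A/√B)`. As `B = A² + (hq)² = L² + (hb)²` with `L = q + g b / 2`, this is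
`(1/h) (arctan (L/(hb)) - arctan (g/(2h)))` for `b > 0`, and that expression plus `π/h` for `b < 0`,
extended continuously through `b = 0`. -/
def χ (y : TangentSpace 𝓘(ℝ, RSpace N) p) : ℝ := 1 / F.h * Real.arccos (F.A y / √(F.B y))

/-- The Finsleroid–Finsler metric function `K = √B exp (-g χ / 2)`, normalized by `K = 1` at the
vector `b^i`. -/
def K (y : TangentSpace 𝓘(ℝ, RSpace N) p) : ℝ := √(F.B y) * Real.exp (-(F.g / 2) * F.χ y)

/-- `λ = (A₁ A₂ + h² r_ij y₁^i y₂^j) / (√B₁ √B₂)`. -/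
def lam (y₁ y₂ : TangentSpace 𝓘(ℝ, RSpace N) p) : ℝ :=
  (F.A y₁ * F.A y₂ + F.h ^ 2 * F.r y₁ y₂) / (√(F.B y₁) * √(F.B y₂))

/-- The Finsleroid angle `α = (1/h) arccos λ`. -/
def angle (y₁ y₂ : TangentSpace 𝓘(ℝ, RSpace N) p) : ℝ := 1 / F.h * Real.arccos (F.lam y₁ y₂)

/-- The Finsleroid scalar product `⟨y₁, y₂⟩ = K₁ K₂ cos α`. -/
def scalarProduct (y₁ y₂ : TangentSpace 𝓘(ℝ, RSpace N) p) : ℝ :=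
  F.K y₁ * F.K y₂ * Real.cos (F.angle y₁ y₂)

end Fibre

/-! ### Local coordinates -/

section Coordinates

/-- The tangent vector at the point with coordinates `u` in the chart `e` whose components in the
chart are `y`, that is `y^i ∂/∂x^i`. -/
def ofCoord (e : OpenPartialHomeomorph M (RSpace N)) (u y : RSpace N) :
    TangentSpace 𝓘(ℝ, RSpace N) (e.symm u) :=
  mfderiv 𝓘(ℝ, RSpace N) 𝓘(ℝ, RSpace N) e.symm u y

/-- The components in the chart `e` of a tangent vector at `p`. -/
def toCoord (e : OpenPartialHomeomorph M (RSpace N)) {p : M}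
    (v : TangentSpace 𝓘(ℝ, RSpace N) p) : RSpace N :=
  mfderiv 𝓘(ℝ, RSpace N) 𝓘(ℝ, RSpace N) e p v

variable (e : OpenPartialHomeomorph M (RSpace N))

/-- The components `a_ij` of the Riemannian metric in the chart `e`. -/
def aCoord (u : RSpace N) : Matrix (Fin N) (Fin N) ℝ :=
  Matrix.of fun i j => F.a.inner (e.symm u)
    (ofCoord e u (EuclideanSpace.single i 1)) (ofCoord e u (EuclideanSpace.single j 1))

/-- The components `b_i` of the 1-form in the chart `e`. -/
def bCoord (u : RSpace N) (i : Fin N) : ℝ :=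
  F.b (e.symm u) (ofCoord e u (EuclideanSpace.single i 1))

/-- `∇_i b_j = ∂_i b_j - a^l_ij b_l`, where `a^l_ij` are the Christoffel symbols of `a`. -/
def nablaB (u : RSpace N) (i j : Fin N) : ℝ :=
  partialDeriv i (fun w => F.bCoord e w j) u
    - ∑ l, christoffel (F.aCoord e) u l i j * F.bCoord e u l

/-- The metric function `K(x, y)` in the chart `e`. -/
def KCoord (u y : RSpace N) : ℝ := F.K (ofCoord e u y)

/-- The scalar product `⟨y₁, y₂⟩_x` in the chart `e`. -/
def scalarProductCoord (u y₁ y₂ : RSpace N) : ℝ :=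
  F.scalarProduct (ofCoord e u y₁) (ofCoord e u y₂)

end Coordinates

/-- The Landsberg case: `∇_i b_j = k (a_ij - b_i b_j)` in all local coordinates, for some scalar
`k` on `M`. -/
def IsLandsbergCase : Prop :=
  ∃ k : M → ℝ, ∀ e ∈ IsManifold.maximalAtlas 𝓘(ℝ, RSpace N) ∞ M, ∀ u ∈ e.target, ∀ i j,
    F.nablaB e u i j = k (e.symm u) * (F.aCoord e u i j - F.bCoord e u i * F.bCoord e u j)

/-- The absolute length `√(g_ij(x, y) y^i y^j)` of a tangent vector `y` at `p`, computed in the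
preferred chart at `p`. -/
def absLength {p : M} (y : TangentSpace 𝓘(ℝ, RSpace N) p) : ℝ :=
  let e := chartAt (RSpace N) p
  let v : RSpace N := toCoord e y
  √(∑ i, ∑ j, Finsler.metricTensor (F.KCoord e) (e p) v i j * v i * v j)

/-- The absolute angle `arccos (⟨y₁, y₂⟩ / (‖y₁‖ ‖y₂‖))`. -/
def absAngle {p : M} (y₁ y₂ : TangentSpace 𝓘(ℝ, RSpace N) p) : ℝ :=
  Real.arccos (F.scalarProduct y₁ y₂ / (F.absLength y₁ * F.absLength y₂))

/-- A vector field `Y` along a curve `c : I → M` (`I` an interval) is parallel, `δY = 0`, if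
`dY^i + Ḡ^i_k(c, Y) dc^k = 0` at each time, in some chart around the current point. (The condition
does not depend on the chart.) -/
def IsParallelAlong (I : Set ℝ) (c : ℝ → M)
    (Y : ∀ t : ℝ, TangentSpace 𝓘(ℝ, RSpace N) (c t)) : Prop :=
  ContinuousOn c I ∧
  ∀ t ∈ I, ∃ e ∈ IsManifold.maximalAtlas 𝓘(ℝ, RSpace N) ∞ M, c t ∈ e.source ∧
    ∃ dx dy : RSpace N,
      HasDerivWithinAt (fun s => e (c s)) dx I t ∧
      HasDerivWithinAt (fun s => (toCoord e (Y s) : RSpace N)) dy I t ∧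
      ∀ i, dy i + ∑ k, Finsler.connection (F.KCoord e) (e (c t)) (toCoord e (Y t)) i k * dx k = 0

end FinsleroidSpace

end

/-!
In the Landsberg case the nonlinear connection of a Finsleroid–Finsler space is explicit. Off the
axis `w` dual to `b`, the spray is `Γ(y, y) + g k q (y - b(y) w)` with `Γ` the Levi-Civita
connection of `a` (`LocalFinsleroid.spray_eq`), so that the connection is
`Γ(ξ, y) + (g k / 2) ((r(y, ξ) / q) (y - b(y) w) + q (ξ - b(ξ) w))`
(`LocalFinsleroid.connection_eq`). The spray is identified through the Euler–Lagrange equation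
`G(z, spray) = D_x[p(z)](y) - ½ D_x[K²](z)`, where `p = ½ ∂K²/∂y` and `G = ½ ∂²K²/∂y∂y`: Euler's
relations turn the Christoffel symbols of `G` contracted with `y` into this expression, and `G` is
positive definite (`LocalFinsleroid.G_pos`), hence invertible.

When the tangent spaces along a curve are identified by isometries that carry `w` to `w`, transport
by this connection preserves `K` and acts on the unit vectors `(A, h y_⊥) / √B`, with
`y_⊥ = y - b(y) w`, by rotations. Consequently `K` and the cosine `λ` of the Euclidean angle between
two such vectors have derivative zero along any curve with parallel fields
(`LocalFinsleroid.hasDerivWithinAt_K_parallel`, `LocalFinsleroid.hasDerivWithinAt_lam_parallel`). The scalar product is `K₁ K₂ φ(λ)` with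
`φ(s) = cos ((1/h) arccos s)`. Its horizontal derivative is the derivative along a line with
horizontal velocity, which vanishes. Differentiability at `λ = 1` holds because `φ` has a one-sided
derivative there and `λ ≤ 1` everywhere.

Along a curve in the manifold, two fields may be parallel with respect to different charts at the
same time, so the independence of parallelism of the chart is needed. It follows from the explicit
form of the connection and the transformation law of `Γ`
(`LocalFinsleroid.IsTransition.Γ_eq`), which holds because a torsion-free metric connection is
unique.
-/

/-! ### The Finsleroid functions of the two scalars `b` and `q` -/

namespace Finsleroid

/-- The Finsleroid characteristic quadratic form `B = b² + g b q + q²`. -/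
noncomputable def quadForm (g b q : ℝ) : ℝ := b ^ 2 + g * b * q + q ^ 2

/-- The factor `κ = K² / B = exp (-g χ)`. -/
noncomputable def kappa (g b q : ℝ) : ℝ :=
  Real.exp (-g * (1 / √(1 - g ^ 2 / 4) * Real.arccos ((b + g / 2 * q) / √(quadForm g b q))))

variable {g : ℝ}

lemma one_sub_sq_pos (h₁ : -2 < g) (h₂ : g < 2) : 0 < 1 - g ^ 2 / 4 := by nlinarith

lemma quadForm_eq (g b q : ℝ) :
    quadForm g b q = (b + g / 2 * q) ^ 2 + (1 - g ^ 2 / 4) * q ^ 2 := by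
  unfold quadForm; ring

lemma quadForm_pos (h₁ : -2 < g) (h₂ : g < 2) (b : ℝ) {q : ℝ} (hq : 0 < q) :
    0 < quadForm g b q := by
  have := one_sub_sq_pos h₁ h₂
  rw [quadForm_eq]; positivity

lemma quadForm_nonneg (h₁ : -2 < g) (h₂ : g < 2) (b q : ℝ) : 0 ≤ quadForm g b q := by
  have := one_sub_sq_pos h₁ h₂
  rw [quadForm_eq]; positivity

lemma kappa_pos (g b q : ℝ) : 0 < kappa g b q := Real.exp_pos _

/-- Off the axis the arc cosine in `κ` is an arc tangent with a nonvanishing denominator, so that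
`κ` is visibly smooth there. -/
lemma kappa_eq_arctan (h₁ : -2 < g) (h₂ : g < 2) (b : ℝ) {q : ℝ} (hq : 0 < q) :
    kappa g b q = Real.exp (-g * (1 / √(1 - g ^ 2 / 4) *
      (Real.pi / 2 - Real.arctan ((b + g / 2 * q) / (√(1 - g ^ 2 / 4) * q))))) := by
  have hh := one_sub_sq_pos h₁ h₂
  have hH : 0 < √(1 - g ^ 2 / 4) := Real.sqrt_pos.2 hh
  have hH2 : √(1 - g ^ 2 / 4) ^ 2 = 1 - g ^ 2 / 4 := Real.sq_sqrt hh.le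
  rw [Real.arctan_eq_arcsin, kappa, Real.arccos]
  generalize √(1 - g ^ 2 / 4) = H at hH hH2
  have hs : 0 < H * q := mul_pos hH hq
  have hroot : √(quadForm g b q) = H * q * √(1 + ((b + g / 2 * q) / (H * q)) ^ 2) := by
    rw [← Real.sqrt_sq hs.le, ← Real.sqrt_mul (sq_nonneg _), Real.sqrt_sq hs.le]
    congr 1
    rw [quadForm_eq, ← hH2]
    field_simp
    ring
  rw [hroot, div_div]

lemma differentiableAt_div {X : Type*} [NormedAddCommGroup X] [NormedSpace ℝ X] {f d : X → ℝ}
    {z : X} (hf : DifferentiableAt ℝ f z) (hd : DifferentiableAt ℝ d z) (h0 : d z ≠ 0) :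
    DifferentiableAt ℝ (fun c => f c / d c) z := by
  simp only [div_eq_mul_inv]
  exact hf.mul (hd.inv h0)

lemma differentiableAt_kappa (h₁ : -2 < g) (h₂ : g < 2) {z : ℝ × ℝ} (hz : 0 < z.2) :
    DifferentiableAt ℝ (fun z : ℝ × ℝ => kappa g z.1 z.2) z := by
  have hh := Real.sqrt_pos.2 (one_sub_sq_pos h₁ h₂)
  have hev : (fun z : ℝ × ℝ => kappa g z.1 z.2) =ᶠ[nhds z] fun z =>
      Real.exp (-g * (1 / √(1 - g ^ 2 / 4) *
      (Real.pi / 2 - Real.arctan ((z.1 + g / 2 * z.2) / (√(1 - g ^ 2 / 4) * z.2))))) := by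
    filter_upwards [(isOpen_lt continuous_const continuous_snd).mem_nhds hz] with w hw
    exact kappa_eq_arctan h₁ h₂ _ hw
  refine DifferentiableAt.congr_of_eventuallyEq ?_ hev
  have : √(1 - g ^ 2 / 4) * z.2 ≠ 0 := (mul_pos hh hz).ne'
  refine DifferentiableAt.exp (DifferentiableAt.const_mul (DifferentiableAt.const_mul
    (DifferentiableAt.const_sub (DifferentiableAt.arctan ?_) _) _) _)
  have hn : DifferentiableAt ℝ (fun z : ℝ × ℝ => z.1 + g / 2 * z.2) z := by fun_prop
  have hd : DifferentiableAt ℝ (fun z : ℝ × ℝ => √(1 - g ^ 2 / 4) * z.2) z := by fun_prop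
  exact differentiableAt_div hn hd this

variable {b q : ℝ → ℝ} {b' q' : ℝ} {s : Set ℝ} {t : ℝ}

lemma hasDerivWithinAt_quadForm (hb : HasDerivWithinAt b b' s t) (hq : HasDerivWithinAt q q' s t) :
    HasDerivWithinAt (fun τ => quadForm g (b τ) (q τ))
      ((2 * b t + g * q t) * b' + (g * b t + 2 * q t) * q') s t := by
  unfold quadForm
  refine ((((hb.pow 2).add ((hb.const_mul g).mul hq)).add (hq.pow 2))).congr_deriv ?_
  simp only [Nat.cast_ofNat]; ring

/-- `d κ = (g κ / B) (q db - b dq)`. -/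
lemma hasDerivWithinAt_kappa (h₁ : -2 < g) (h₂ : g < 2)
    (hb : HasDerivWithinAt b b' s t) (hq : HasDerivWithinAt q q' s t) (hpos : 0 < q t) :
    HasDerivWithinAt (fun τ => kappa g (b τ) (q τ))
      (g * kappa g (b t) (q t) / quadForm g (b t) (q t) * (q t * b' - b t * q')) s t := by
  have hh2 := one_sub_sq_pos h₁ h₂
  have hh := Real.sqrt_pos.2 hh2
  have hev : (fun τ => kappa g (b τ) (q τ)) =ᶠ[nhdsWithin t s] fun τ =>
      Real.exp (-g * (1 / √(1 - g ^ 2 / 4) * (Real.pi / 2 -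
        Real.arctan ((b τ + g / 2 * q τ) / (√(1 - g ^ 2 / 4) * q τ))))) := by
    filter_upwards [hq.continuousWithinAt.eventually (lt_mem_nhds hpos)] with τ hτ
    exact kappa_eq_arctan h₁ h₂ _ hτ
  refine HasDerivWithinAt.congr_of_eventuallyEq ?_ hev (kappa_eq_arctan h₁ h₂ _ hpos)
  rw [kappa_eq_arctan h₁ h₂ _ hpos]
  have hH2 : √(1 - g ^ 2 / 4) ^ 2 = 1 - g ^ 2 / 4 := Real.sq_sqrt hh2.le
  clear hev
  generalize √(1 - g ^ 2 / 4) = H at hh hH2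
  have hne : H * q t ≠ 0 := (mul_pos hh hpos).ne'
  have key := (((((hb.add (hq.const_mul (g / 2))).div (hq.const_mul H) hne).arctan
    ).const_sub (Real.pi / 2)).const_mul (1 / H)).const_mul (-g) |>.exp
  refine key.congr_deriv ?_
  have hB := quadForm_pos h₁ h₂ (b t) hpos
  have hden : (1 : ℝ) + ((b t + g / 2 * q t) / (H * q t)) ^ 2 =
      quadForm g (b t) (q t) / (H * q t) ^ 2 := by
    rw [quadForm_eq, ← hH2]; field_simp; ring
  simp only [Pi.add_apply, Pi.div_apply]
  rw [hden]
  field_simp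
  ring

/-- `K² = B κ` has the differential `(2 K² / B) ((b + g q) db + q dq)`. -/
lemma hasDerivWithinAt_quadForm_mul_kappa (h₁ : -2 < g) (h₂ : g < 2)
    (hb : HasDerivWithinAt b b' s t) (hq : HasDerivWithinAt q q' s t) (hpos : 0 < q t) :
    HasDerivWithinAt (fun τ => quadForm g (b τ) (q τ) * kappa g (b τ) (q τ))
      (2 * kappa g (b t) (q t) * ((b t + g * q t) * b' + q t * q')) s t := by
  refine ((hasDerivWithinAt_quadForm hb hq).mul
    (hasDerivWithinAt_kappa h₁ h₂ hb hq hpos)).congr_deriv ?_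
  have hB := quadForm_pos h₁ h₂ (b t) hpos
  field_simp
  ring

end Finsleroid

/-! ### Finsleroid data on an open subset of the coordinate space -/

/-- A Finsleroid space of Landsberg type in local coordinates: the Riemannian metric `a`, the unit
1-form `b` with its dual vector field `w`, and the Levi-Civita connection `Γ` of `a`, given by the
properties that determine it (absence of torsion, compatibility with `a`). The last field is the
Landsberg condition `∇b = k (a - b ⊗ b)`. -/
structure LocalFinsleroid (N : ℕ) where
  /-- The coordinate domain. -/
  U : Set (RSpace N)
  isOpen_U : IsOpen U
  /-- The Riemannian metric. -/
  a : RSpace N → RSpace N →L[ℝ] RSpace N →L[ℝ] ℝ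
  /-- The axis 1-form. -/
  b : RSpace N → RSpace N →L[ℝ] ℝ
  /-- The vector field dual to `b`. -/
  w : RSpace N → RSpace N
  /-- The Levi-Civita connection of `a`. -/
  Γ : RSpace N → RSpace N →L[ℝ] RSpace N →L[ℝ] RSpace N
  /-- The scalar of the Landsberg condition. -/
  k : RSpace N → ℝ
  /-- The Finsleroid charge. -/
  g : ℝ
  g_gt : -2 < g
  g_lt : g < 2
  diff_a : ∀ u ∈ U, DifferentiableAt ℝ a u
  diff_b : ∀ u ∈ U, DifferentiableAt ℝ b u
  a_symm : ∀ u ∈ U, ∀ v z, a u v z = a u z v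
  a_pos : ∀ u ∈ U, ∀ v, v ≠ 0 → 0 < a u v v
  a_w : ∀ u ∈ U, ∀ v, a u (w u) v = b u v
  b_w : ∀ u ∈ U, b u (w u) = 1
  Γ_symm : ∀ u ∈ U, ∀ v z, Γ u v z = Γ u z v
  fderiv_a : ∀ u ∈ U, ∀ ξ v z, fderiv ℝ a u ξ v z = a u (Γ u ξ v) z + a u v (Γ u ξ z)
  fderiv_b : ∀ u ∈ U, ∀ ξ v, fderiv ℝ b u ξ v = k u * (a u ξ v - b u ξ * b u v) + b u (Γ u ξ v)

namespace LocalFinsleroid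

open Finsleroid

variable {N : ℕ} (D : LocalFinsleroid N)

/-- `r = a - b ⊗ b`. -/
noncomputable def r (u y₁ y₂ : RSpace N) : ℝ := D.a u y₁ y₂ - D.b u y₁ * D.b u y₂

/-- `q = √(r(y, y))`. -/
noncomputable def q (u y : RSpace N) : ℝ := √(D.r u y y)

/-- `B = b² + g b q + q²`. -/
noncomputable def B (u y : RSpace N) : ℝ := quadForm D.g (D.b u y) (D.q u y)

/-- `κ = K² / B`. -/
noncomputable def κ (u y : RSpace N) : ℝ := kappa D.g (D.b u y) (D.q u y)

/-- The metric function `K`. -/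
noncomputable def K (u y : RSpace N) : ℝ :=
  √(D.B u y) * Real.exp (-(D.g / 2) * (1 / √(1 - D.g ^ 2 / 4) *
    Real.arccos ((D.b u y + D.g / 2 * D.q u y) / √(D.B u y))))

/-- The cosine `λ` of the reduced angle. -/
noncomputable def lam (u y₁ y₂ : RSpace N) : ℝ :=
  ((D.b u y₁ + D.g / 2 * D.q u y₁) * (D.b u y₂ + D.g / 2 * D.q u y₂)
    + √(1 - D.g ^ 2 / 4) ^ 2 * D.r u y₁ y₂) / (√(D.B u y₁) * √(D.B u y₂))

/-- The covector `p = ½ ∂K²/∂y`. -/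
noncomputable def p (u y z : RSpace N) : ℝ :=
  D.κ u y * (D.a u y z + D.g * D.q u y * D.b u z)

/-- The Hessian `½ ∂²K²/∂y∂y`. -/
noncomputable def G (u y v z : RSpace N) : ℝ :=
  D.κ u y * (D.a u v z + D.g * D.q u y / D.B u y *
    ((D.b u y + D.g * D.q u y) * D.b u v * D.b u z + D.b u v * D.r u y z + D.b u z * D.r u y v
      - D.b u y / D.q u y ^ 2 * D.r u y v * D.r u y z))

variable {D}

lemma r_add_right (u y v z : RSpace N) : D.r u y (v + z) = D.r u y v + D.r u y z := by
  simp [r]; ring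

lemma r_add_left (u y v z : RSpace N) : D.r u (v + z) y = D.r u v y + D.r u z y := by
  simp [r]; ring

lemma r_smul_right (u y v : RSpace N) (c : ℝ) : D.r u y (c • v) = c * D.r u y v := by
  simp [r]; ring

lemma r_smul_left (u y v : RSpace N) (c : ℝ) : D.r u (c • v) y = c * D.r u v y := by
  simp [r]; ring

lemma r_sub_right (u y v z : RSpace N) : D.r u y (v - z) = D.r u y v - D.r u y z := by
  simp [r]; ring

lemma r_sub_left (u y v z : RSpace N) : D.r u (v - z) y = D.r u v y - D.r u z y := by
  simp [r]; ring

lemma r_neg_left (u y v : RSpace N) : D.r u (-v) y = -D.r u v y := by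
  simp [r]; ring

variable {u : RSpace N}

lemma r_symm (hu : u ∈ D.U) (v z : RSpace N) : D.r u v z = D.r u z v := by
  simp [r, D.a_symm u hu v z, mul_comm]

lemma r_w_left (hu : u ∈ D.U) (v : RSpace N) : D.r u (D.w u) v = 0 := by
  simp [r, D.a_w u hu, D.b_w u hu]

lemma r_w_right (hu : u ∈ D.U) (v : RSpace N) : D.r u v (D.w u) = 0 := by
  rw [r_symm hu, r_w_left hu]

/-- `r(v, v)` is the squared length of the component of `v` orthogonal to `w`. -/
lemma r_self_eq (hu : u ∈ D.U) (v : RSpace N) :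
    D.r u v v = D.a u (v - D.b u v • D.w u) (v - D.b u v • D.w u) := by
  have h1 := D.a_symm u hu v (D.w u)
  simp [r, D.a_w u hu, D.b_w u hu, h1]

lemma r_self_nonneg (hu : u ∈ D.U) (v : RSpace N) : 0 ≤ D.r u v v := by
  rw [r_self_eq hu]
  by_cases h : v - D.b u v • D.w u = 0
  · simp [h]
  · exact (D.a_pos u hu _ h).le

lemma q_sq (hu : u ∈ D.U) (v : RSpace N) : D.q u v ^ 2 = D.r u v v :=
  Real.sq_sqrt (r_self_nonneg hu v)

/-- The Cauchy–Schwarz inequality for `r`. -/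
lemma r_sq_le (hu : u ∈ D.U) (v z : RSpace N) : D.r u v z ^ 2 ≤ D.r u v v * D.r u z z := by
  have h : ∀ c : ℝ, 0 ≤ D.r u z z * (c * c) + (2 * D.r u v z) * c + D.r u v v := fun c => by
    have := r_self_nonneg hu (v + c • z)
    simp only [r_add_left, r_add_right, r_smul_left, r_smul_right, r_symm hu z v] at this
    linarith
  have := discrim_le_zero h
  unfold discrim at this
  linarith

lemma B_pos (D : LocalFinsleroid N) {u y : RSpace N} (hq : 0 < D.q u y) : 0 < D.B u y :=
  quadForm_pos D.g_gt D.g_lt _ hq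

lemma κ_pos (D : LocalFinsleroid N) (u y : RSpace N) : 0 < D.κ u y := kappa_pos _ _ _

lemma K_sq (D : LocalFinsleroid N) (u y : RSpace N) : D.K u y ^ 2 = D.B u y * D.κ u y := by
  rw [K, mul_pow, Real.sq_sqrt (show 0 ≤ D.B u y from quadForm_nonneg D.g_gt D.g_lt _ _),
    ← Real.exp_nat_mul, κ, kappa]
  congr 2
  rw [B]
  push_cast
  ring

lemma K_eq_sqrt (D : LocalFinsleroid N) (u y : RSpace N) : D.K u y = √(D.B u y * D.κ u y) := by
  rw [← K_sq, Real.sqrt_sq (by unfold K; positivity)]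

/-- `λ ∈ [-1, 1]`: it is the cosine of a Euclidean angle. -/
lemma abs_lam_le_one (hu : u ∈ D.U) {y₁ y₂ : RSpace N} (h₁ : 0 < D.q u y₁) (h₂ : 0 < D.q u y₂) :
    |D.lam u y₁ y₂| ≤ 1 := by
  have hB₁ := D.B_pos h₁
  have hB₂ := D.B_pos h₂
  have hpos : 0 < √(D.B u y₁) * √(D.B u y₂) := mul_pos (Real.sqrt_pos.2 hB₁) (Real.sqrt_pos.2 hB₂)
  have hh := one_sub_sq_pos D.g_gt D.g_lt
  rw [lam, abs_div, abs_of_pos hpos, div_le_one hpos, Real.sq_sqrt hh.le,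
    ← Real.sqrt_mul hB₁.le]
  refine Real.abs_le_sqrt ?_
  have hq₁ := q_sq hu y₁
  have hq₂ := q_sq hu y₂
  have hcs := r_sq_le hu y₁ y₂
  rw [B, B, quadForm_eq, quadForm_eq]
  set A₁ := D.b u y₁ + D.g / 2 * D.q u y₁
  set A₂ := D.b u y₂ + D.g / 2 * D.q u y₂
  -- the cross terms of the Lagrange identity are `r` evaluated on `A₁ y₂ - A₂ y₁`
  have hr := r_self_nonneg hu (A₁ • y₂ - A₂ • y₁)
  simp only [r_sub_left, r_sub_right, r_smul_left, r_smul_right, r_symm hu y₂ y₁] at hr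
  rw [hq₁, hq₂]
  nlinarith [mul_nonneg hh.le hr, mul_nonneg (sq_nonneg (1 - D.g ^ 2 / 4)) (sub_nonneg.2 hcs)]

end LocalFinsleroid

/-! ### Covariant differentiation along curves -/

namespace LocalFinsleroid

open Finsleroid

variable {N : ℕ} {D : LocalFinsleroid N}

section Curves

variable {x y y₁ y₂ : ℝ → RSpace N} {ξ η η₁ η₂ : RSpace N} {s : Set ℝ} {t : ℝ}

/-- Along a curve, `d b(y) = k r(dx, y) + b(∇y)`, where `∇y = dy + Γ(dx, y)`. -/
lemma hasDerivWithinAt_b (hU : x t ∈ D.U) (hx : HasDerivWithinAt x ξ s t)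
    (hy : HasDerivWithinAt y η s t) :
    HasDerivWithinAt (fun τ => D.b (x τ) (y τ))
      (D.k (x t) * D.r (x t) ξ (y t) + D.b (x t) (η + D.Γ (x t) ξ (y t))) s t := by
  refine (((D.diff_b _ hU).hasFDerivAt.comp_hasDerivWithinAt t hx).clm_apply hy).congr_deriv ?_
  simp only [D.fderiv_b _ hU, r, map_add, Function.comp_apply]; ring

/-- Along a curve, `d a(y₁, y₂) = a(∇y₁, y₂) + a(y₁, ∇y₂)`. -/
lemma hasDerivWithinAt_a (hU : x t ∈ D.U) (hx : HasDerivWithinAt x ξ s t)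
    (hy₁ : HasDerivWithinAt y₁ η₁ s t) (hy₂ : HasDerivWithinAt y₂ η₂ s t) :
    HasDerivWithinAt (fun τ => D.a (x τ) (y₁ τ) (y₂ τ))
      (D.a (x t) (η₁ + D.Γ (x t) ξ (y₁ t)) (y₂ t)
        + D.a (x t) (y₁ t) (η₂ + D.Γ (x t) ξ (y₂ t))) s t := by
  have h1 : HasDerivWithinAt (fun τ => D.a (x τ)) (fderiv ℝ D.a (x t) ξ) s t :=
    HasFDerivAt.comp_hasDerivWithinAt (E := RSpace N →L[ℝ] RSpace N →L[ℝ] ℝ) t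
      (D.diff_a _ hU).hasFDerivAt hx
  have h2 : HasDerivWithinAt (fun τ => D.a (x τ) (y₁ τ))
    (fderiv ℝ D.a (x t) ξ (y₁ t) + D.a (x t) η₁) s t := h1.clm_apply hy₁
  refine (h2.clm_apply hy₂).congr_deriv ?_
  simp only [D.fderiv_a _ hU, map_add, add_apply]; ring

lemma hasDerivWithinAt_r (hU : x t ∈ D.U) (hx : HasDerivWithinAt x ξ s t)
    (hy₁ : HasDerivWithinAt y₁ η₁ s t) (hy₂ : HasDerivWithinAt y₂ η₂ s t) :
    HasDerivWithinAt (fun τ => D.r (x τ) (y₁ τ) (y₂ τ))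
      (D.r (x t) (η₁ + D.Γ (x t) ξ (y₁ t)) (y₂ t) + D.r (x t) (y₁ t) (η₂ + D.Γ (x t) ξ (y₂ t))
        - D.k (x t) * (D.r (x t) ξ (y₁ t) * D.b (x t) (y₂ t)
          + D.b (x t) (y₁ t) * D.r (x t) ξ (y₂ t))) s t := by
  refine ((hasDerivWithinAt_a hU hx hy₁ hy₂).sub
    ((hasDerivWithinAt_b hU hx hy₁).mul (hasDerivWithinAt_b hU hx hy₂))).congr_deriv ?_
  simp only [r]; ring

lemma hasDerivWithinAt_q (hU : x t ∈ D.U) (hx : HasDerivWithinAt x ξ s t)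
    (hy : HasDerivWithinAt y η s t) (hq : 0 < D.q (x t) (y t)) :
    HasDerivWithinAt (fun τ => D.q (x τ) (y τ))
      ((D.r (x t) (y t) (η + D.Γ (x t) ξ (y t))
        - D.k (x t) * (D.b (x t) (y t) * D.r (x t) ξ (y t))) / D.q (x t) (y t)) s t := by
  have h0 : D.r (x t) (y t) (y t) ≠ 0 := by rw [← q_sq hU]; positivity
  refine ((hasDerivWithinAt_r hU hx hy hy).sqrt h0).congr_deriv ?_
  rw [r_symm hU (η + _)]
  change _ / (2 * D.q (x t) (y t)) = _
  field_simp; ring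

/-- The derivative of `K² = B κ` along a curve: `2 p(∇y) + 2 κ k g q r(dx, y)`. -/
lemma hasDerivWithinAt_K_sq (hU : x t ∈ D.U) (hx : HasDerivWithinAt x ξ s t)
    (hy : HasDerivWithinAt y η s t) (hq : 0 < D.q (x t) (y t)) :
    HasDerivWithinAt (fun τ => D.K (x τ) (y τ) ^ 2)
      (2 * (D.p (x t) (y t) (η + D.Γ (x t) ξ (y t)) + D.κ (x t) (y t) * D.k (x t) * D.g *
        D.q (x t) (y t) * D.r (x t) ξ (y t))) s t := by
  simp only [K_sq]
  refine (hasDerivWithinAt_quadForm_mul_kappa D.g_gt D.g_lt (hasDerivWithinAt_b hU hx hy)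
    (hasDerivWithinAt_q hU hx hy hq) hq).congr_deriv ?_
  change 2 * D.κ (x t) (y t) * _ = _
  generalize η + D.Γ (x t) ξ (y t) = ζ
  have : D.a (x t) (y t) ζ = D.r (x t) (y t) ζ + D.b (x t) (y t) * D.b (x t) ζ := by
    simp [r]
  rw [p, this]
  field_simp; ring

lemma hasDerivWithinAt_κ (hU : x t ∈ D.U) (hx : HasDerivWithinAt x ξ s t)
    (hy : HasDerivWithinAt y η s t) (hq : 0 < D.q (x t) (y t)) :
    HasDerivWithinAt (fun τ => D.κ (x τ) (y τ))
      (D.g * D.κ (x t) (y t) / (D.B (x t) (y t) * D.q (x t) (y t)) *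
        (D.q (x t) (y t) ^ 2 * D.b (x t) (η + D.Γ (x t) ξ (y t))
          - D.b (x t) (y t) * D.r (x t) (y t) (η + D.Γ (x t) ξ (y t))
          + (D.q (x t) (y t) ^ 2 + D.b (x t) (y t) ^ 2) * D.k (x t) * D.r (x t) ξ (y t))) s t := by
  refine (hasDerivWithinAt_kappa D.g_gt D.g_lt (hasDerivWithinAt_b hU hx hy)
    (hasDerivWithinAt_q hU hx hy hq) hq).congr_deriv ?_
  change D.g * D.κ (x t) (y t) / D.B (x t) (y t) * _ = _
  have := D.B_pos hq
  field_simp; ring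

/-- The derivative of the covector `p` along a curve, in terms of the Hessian `G`. -/
lemma hasDerivWithinAt_p (hU : x t ∈ D.U) (hx : HasDerivWithinAt x ξ s t)
    (hy : HasDerivWithinAt y η s t) (hq : 0 < D.q (x t) (y t)) (z : RSpace N) :
    HasDerivWithinAt (fun τ => D.p (x τ) (y τ) z)
      (D.G (x t) (y t) z (η + D.Γ (x t) ξ (y t)) + D.p (x t) (y t) (D.Γ (x t) ξ z)
        + D.g * D.k (x t) * D.κ (x t) (y t) * ((D.q (x t) (y t) ^ 2 + D.b (x t) (y t) ^ 2)
            * D.r (x t) ξ (y t) / (D.B (x t) (y t) * D.q (x t) (y t)) *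
              (D.a (x t) (y t) z + D.g * D.q (x t) (y t) * D.b (x t) z)
          - D.b (x t) (y t) * D.r (x t) ξ (y t) / D.q (x t) (y t) * D.b (x t) z
          + D.q (x t) (y t) * D.r (x t) ξ z)) s t := by
  have hz := hasDerivWithinAt_const t s z
  refine ((hasDerivWithinAt_κ hU hx hy hq).mul ((hasDerivWithinAt_a hU hx hy hz).add
    (((hasDerivWithinAt_q hU hx hy hq).const_mul D.g).mul
      (hasDerivWithinAt_b hU hx hz)))).congr_deriv ?_
  rw [zero_add, p, G]
  generalize η + D.Γ (x t) ξ (y t) = ζ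
  generalize D.Γ (x t) ξ z = σ
  have h1 : D.a (x t) (y t) z = D.r (x t) (y t) z + D.b (x t) (y t) * D.b (x t) z := by
    simp [r]
  have h2 : D.a (x t) ζ z = D.r (x t) z ζ + D.b (x t) ζ * D.b (x t) z := by
    rw [r_symm hU]; simp [r]
  have h3 : D.a (x t) z ζ = D.r (x t) z ζ + D.b (x t) z * D.b (x t) ζ := by simp [r]
  have hB := D.B_pos hq
  have hBdef : D.B (x t) (y t) = D.b (x t) (y t) ^ 2 +
    D.g * D.b (x t) (y t) * D.q (x t) (y t) + D.q (x t) (y t) ^ 2 := rfl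
  simp only [Pi.add_apply, Pi.mul_apply]
  rw [h1, h2, h3]
  field_simp
  rw [hBdef]
  ring

end Curves

/-! ### Differentiability -/

section Differentiability

variable {X : Type*} [NormedAddCommGroup X] [NormedSpace ℝ X] {x y y₁ y₂ : X → RSpace N} {z : X}

lemma differentiableAt_b (hU : x z ∈ D.U) (hx : DifferentiableAt ℝ x z)
    (hy : DifferentiableAt ℝ y z) : DifferentiableAt ℝ (fun c => D.b (x c) (y c)) z :=
  ((D.diff_b _ hU).comp z hx).clm_apply hy

lemma differentiableAt_a (hU : x z ∈ D.U) (hx : DifferentiableAt ℝ x z)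
    (hy₁ : DifferentiableAt ℝ y₁ z) (hy₂ : DifferentiableAt ℝ y₂ z) :
    DifferentiableAt ℝ (fun c => D.a (x c) (y₁ c) (y₂ c)) z :=
  (((D.diff_a _ hU).comp z hx).clm_apply hy₁).clm_apply hy₂

lemma differentiableAt_r (hU : x z ∈ D.U) (hx : DifferentiableAt ℝ x z)
    (hy₁ : DifferentiableAt ℝ y₁ z) (hy₂ : DifferentiableAt ℝ y₂ z) :
    DifferentiableAt ℝ (fun c => D.r (x c) (y₁ c) (y₂ c)) z :=
  (differentiableAt_a hU hx hy₁ hy₂).sub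
    ((differentiableAt_b hU hx hy₁).mul (differentiableAt_b hU hx hy₂))

lemma differentiableAt_q (hU : x z ∈ D.U) (hx : DifferentiableAt ℝ x z)
    (hy : DifferentiableAt ℝ y z) (hq : 0 < D.q (x z) (y z)) :
    DifferentiableAt ℝ (fun c => D.q (x c) (y c)) z :=
  (differentiableAt_r hU hx hy hy).sqrt (by rw [← q_sq hU]; positivity)

lemma differentiableAt_B (hU : x z ∈ D.U) (hx : DifferentiableAt ℝ x z)
    (hy : DifferentiableAt ℝ y z) (hq : 0 < D.q (x z) (y z)) :
    DifferentiableAt ℝ (fun c => D.B (x c) (y c)) z := by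
  have h1 := differentiableAt_b hU hx hy
  have h2 := differentiableAt_q hU hx hy hq
  unfold B quadForm
  fun_prop

lemma differentiableAt_κ (hU : x z ∈ D.U) (hx : DifferentiableAt ℝ x z)
    (hy : DifferentiableAt ℝ y z) (hq : 0 < D.q (x z) (y z)) :
    DifferentiableAt ℝ (fun c => D.κ (x c) (y c)) z :=
  DifferentiableAt.comp (f := fun c => (D.b (x c) (y c), D.q (x c) (y c))) z
    (differentiableAt_kappa D.g_gt D.g_lt (by exact hq))
    ((differentiableAt_b hU hx hy).prodMk (differentiableAt_q hU hx hy hq))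

lemma differentiableAt_K_sq (hU : x z ∈ D.U) (hx : DifferentiableAt ℝ x z)
    (hy : DifferentiableAt ℝ y z) (hq : 0 < D.q (x z) (y z)) :
    DifferentiableAt ℝ (fun c => D.K (x c) (y c) ^ 2) z := by
  simp only [K_sq]
  exact (differentiableAt_B hU hx hy hq).mul (differentiableAt_κ hU hx hy hq)

lemma differentiableAt_K (hU : x z ∈ D.U) (hx : DifferentiableAt ℝ x z)
    (hy : DifferentiableAt ℝ y z) (hq : 0 < D.q (x z) (y z)) :
    DifferentiableAt ℝ (fun c => D.K (x c) (y c)) z := by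
  simp only [K_eq_sqrt]
  exact ((differentiableAt_B hU hx hy hq).mul (differentiableAt_κ hU hx hy hq)).sqrt
    (mul_pos (D.B_pos hq) (D.κ_pos _ _)).ne'

lemma differentiableAt_lam (hU : x z ∈ D.U) (hx : DifferentiableAt ℝ x z)
    (hy₁ : DifferentiableAt ℝ y₁ z) (hy₂ : DifferentiableAt ℝ y₂ z)
    (hq₁ : 0 < D.q (x z) (y₁ z)) (hq₂ : 0 < D.q (x z) (y₂ z)) :
    DifferentiableAt ℝ (fun c => D.lam (x c) (y₁ c) (y₂ c)) z := by
  have h1 := differentiableAt_b hU hx hy₁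
  have h2 := differentiableAt_b hU hx hy₂
  have h3 := differentiableAt_q hU hx hy₁ hq₁
  have h4 := differentiableAt_q hU hx hy₂ hq₂
  have h5 := differentiableAt_r hU hx hy₁ hy₂
  have h6 := (differentiableAt_B hU hx hy₁ hq₁).sqrt (D.B_pos hq₁).ne'
  have h7 := (differentiableAt_B hU hx hy₂ hq₂).sqrt (D.B_pos hq₂).ne'
  unfold lam
  refine differentiableAt_div (by fun_prop) (h6.mul h7)
    (mul_pos (Real.sqrt_pos.2 (D.B_pos hq₁)) (Real.sqrt_pos.2 (D.B_pos hq₂))).ne'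

lemma differentiableAt_p (hU : x z ∈ D.U) (hx : DifferentiableAt ℝ x z)
    (hy : DifferentiableAt ℝ y z) (hq : 0 < D.q (x z) (y z)) (v : RSpace N) :
    DifferentiableAt ℝ (fun c => D.p (x c) (y c) v) z := by
  have hv : DifferentiableAt ℝ (fun _ : X => v) z := differentiableAt_const v
  have h1 := differentiableAt_κ hU hx hy hq
  have h2 := differentiableAt_a hU hx hy hv
  have h3 := differentiableAt_q hU hx hy hq
  have h4 := differentiableAt_b hU hx hv
  unfold p
  fun_prop

lemma differentiableAt_G (hU : x z ∈ D.U) (hx : DifferentiableAt ℝ x z)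
    (hy : DifferentiableAt ℝ y z) (hq : 0 < D.q (x z) (y z)) (v v' : RSpace N) :
    DifferentiableAt ℝ (fun c => D.G (x c) (y c) v v') z := by
  have hv : DifferentiableAt ℝ (fun _ : X => v) z := differentiableAt_const v
  have hv' : DifferentiableAt ℝ (fun _ : X => v') z := differentiableAt_const v'
  have h1 := differentiableAt_κ hU hx hy hq
  have h2 := differentiableAt_a hU hx hv hv'
  have h3 := differentiableAt_q hU hx hy hq
  have h4 := differentiableAt_b hU hx hv
  have h5 := differentiableAt_b hU hx hv'
  have h6 := differentiableAt_r hU hx hy hv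
  have h7 := differentiableAt_r hU hx hy hv'
  have h8 := differentiableAt_b hU hx hy
  have h9 := (differentiableAt_B hU hx hy hq)
  have h10 : DifferentiableAt ℝ (fun c => D.g * D.q (x c) (y c) / D.B (x c) (y c)) z :=
    differentiableAt_div (h3.const_mul _) h9 (D.B_pos hq).ne'
  have h11 : DifferentiableAt ℝ (fun c => D.b (x c) (y c) / D.q (x c) (y c) ^ 2) z :=
    differentiableAt_div h8 (h3.pow 2) (pow_pos hq 2).ne'
  unfold G
  fun_prop

lemma eventually_q_pos (hU : x z ∈ D.U) (hx : DifferentiableAt ℝ x z)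
    (hy : DifferentiableAt ℝ y z) (hq : 0 < D.q (x z) (y z)) :
    ∀ᶠ c in nhds z, x c ∈ D.U ∧ 0 < D.q (x c) (y c) :=
  (hx.continuousAt.eventually (D.isOpen_U.mem_nhds hU)).and
    ((differentiableAt_q hU hx hy hq).continuousAt.eventually (lt_mem_nhds hq))

end Differentiability

end LocalFinsleroid

/-! ### Partial derivatives and coordinates -/

namespace RSpace

variable {N : ℕ}

lemma fderiv_eq_of_hasDerivAt_line {f : RSpace N → ℝ} {x v : RSpace N} {c : ℝ}
    (hf : DifferentiableAt ℝ f x)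
    (h : HasDerivWithinAt (fun t : ℝ => f (x + t • v)) c Set.univ 0) : fderiv ℝ f x v = c := by
  rw [← hf.lineDeriv_eq_fderiv]
  exact HasLineDerivAt.lineDeriv (hasDerivWithinAt_univ.1 h)

lemma hasDerivWithinAt_line (x v : RSpace N) (s : Set ℝ) (t : ℝ) :
    HasDerivWithinAt (fun τ : ℝ => x + τ • v) v s t := by
  simpa using ((hasDerivWithinAt_id t s).smul_const v).const_add x

lemma linearMap_sum_coord {V : Type*} [AddCommGroup V] [Module ℝ V] (L : RSpace N →ₗ[ℝ] V)
    (y : RSpace N) : ∑ n, y n • L (EuclideanSpace.single n 1) = L y := by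
  conv_rhs => rw [← (EuclideanSpace.basisFun (Fin N) ℝ).sum_repr y]
  simp [map_sum]

/-- The matrix of a positive definite bilinear form is invertible. -/
lemma isUnit_det_of_pos (L : RSpace N →ₗ[ℝ] RSpace N →ₗ[ℝ] ℝ) (hL : ∀ v, v ≠ 0 → 0 < L v v)
    {m : Matrix (Fin N) (Fin N) ℝ}
    (hm : ∀ i j, m i j = L (EuclideanSpace.single i 1) (EuclideanSpace.single j 1)) :
    IsUnit m.det := by
  rw [← Matrix.isUnit_iff_isUnit_det, ← Matrix.mulVec_injective_iff_isUnit]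
  refine (injective_iff_map_eq_zero (Matrix.mulVecLin m)).2 fun v hv => ?_
  by_contra hne
  have hne' : WithLp.toLp 2 v ≠ 0 := fun h => hne (by simpa using congrArg WithLp.ofLp h)
  have := hL (WithLp.toLp 2 v) hne'
  rw [← linearMap_sum_coord L, LinearMap.sum_apply] at this
  have hz : ∀ i, (v i • L (EuclideanSpace.single i 1)) (WithLp.toLp 2 v) = 0 := fun i => by
    rw [LinearMap.smul_apply, ← linearMap_sum_coord (L _)]
    have := congrFun hv i
    simp only [Matrix.mulVecLin_apply, Matrix.mulVec, dotProduct, hm, Pi.zero_apply] at this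
    simp only [smul_eq_mul, mul_comm (v _), this, zero_mul]
  simp [hz] at this

end RSpace

/-! ### The Hessian of `K² / 2` -/

namespace LocalFinsleroid

open Finsleroid RSpace

variable {N : ℕ} {D : LocalFinsleroid N}

/-- The Hessian as a bilinear form. -/
noncomputable def GLin (D : LocalFinsleroid N) (u y : RSpace N) :
    RSpace N →ₗ[ℝ] RSpace N →ₗ[ℝ] ℝ :=
  LinearMap.mk₂ ℝ (D.G u y) (fun _ _ _ => by simp [G, r]; ring) (fun _ _ _ => by simp [G, r]; ring)
    (fun _ _ _ => by simp [G, r]; ring) (fun _ _ _ => by simp [G, r]; ring)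

lemma GLin_apply (u y v z : RSpace N) : D.GLin u y v z = D.G u y v z := rfl

/-- The covector `p` as a linear form. -/
noncomputable def pLin (D : LocalFinsleroid N) (u y : RSpace N) : RSpace N →ₗ[ℝ] ℝ :=
  { toFun := D.p u y
    map_add' := fun _ _ => by simp [p]; ring
    map_smul' := fun _ _ => by simp [p]; ring }

lemma pLin_apply (u y z : RSpace N) : D.pLin u y z = D.p u y z := rfl

variable {u y : RSpace N}

lemma G_symm (hu : u ∈ D.U) (v z : RSpace N) : D.G u y v z = D.G u y z v := by
  rw [G, G, D.a_symm u hu v z]; ring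

/-- Euler's relation for the homogeneous function `p`. -/
lemma G_self (hu : u ∈ D.U) (hq : 0 < D.q u y) (z : RSpace N) : D.G u y z y = D.p u y z := by
  have hB := D.B_pos hq
  have hBdef : D.B u y = D.b u y ^ 2 + D.g * D.b u y * D.q u y + D.q u y ^ 2 := rfl
  rw [G, p, ← q_sq hu, D.a_symm u hu z y]
  field_simp
  rw [hBdef]; ring

/-- Euler's relation for the homogeneous function `K²`. -/
lemma p_self (hu : u ∈ D.U) : D.p u y y = D.K u y ^ 2 := by
  have hBdef : D.B u y = D.b u y ^ 2 + D.g * D.b u y * D.q u y + D.q u y ^ 2 := rfl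
  rw [K_sq, p, hBdef, q_sq hu, r]; ring

lemma G_pos (hu : u ∈ D.U) (hq : 0 < D.q u y) {z : RSpace N} (hz : z ≠ 0) : 0 < D.G u y z z := by
  have hB := D.B_pos hq
  have hBdef : D.B u y = D.b u y ^ 2 + D.g * D.b u y * D.q u y + D.q u y ^ 2 := rfl
  have hcs := r_sq_le hu y z
  rw [← q_sq hu] at hcs
  have ha : 0 < D.b u z ^ 2 + D.r u z z := by
    have := D.a_pos u hu z hz
    simp only [r]; nlinarith
  set b := D.b u y
  set q := D.q u y
  set c := D.b u z
  set ρ := D.r u y z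
  -- with `t = ρ / q`, the form is bounded below by a quadratic form in `(c, t)` of determinant `1`
  obtain ⟨t, ht⟩ : ∃ t, ρ = q * t := ⟨ρ / q, by field_simp⟩
  obtain ⟨d, hd⟩ : ∃ d, D.r u z z = t ^ 2 + d := ⟨D.r u z z - t ^ 2, by ring⟩
  have hd0 : 0 ≤ d := by
    have h : 0 ≤ q ^ 2 * d := by rw [ht, hd] at hcs; nlinarith
    exact nonneg_of_mul_nonneg_right h (by positivity)
  have hform : D.G u y z z = D.κ u y / D.B u y *
      ((b ^ 2 + 2 * D.g * b * q + (1 + D.g ^ 2) * q ^ 2) * c ^ 2 + 2 * D.g * q ^ 2 * c * t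
        + (b ^ 2 + q ^ 2) * t ^ 2 + D.B u y * d) := by
    have h1 : D.a u z z = c ^ 2 + (t ^ 2 + d) := by rw [← hd]; simp only [r, c]; ring
    have h2 : D.G u y z z = D.κ u y * (D.a u z z + D.g * q / D.B u y *
      ((b + D.g * q) * c * c + c * ρ + c * ρ - b / q ^ 2 * ρ * ρ)) := rfl
    rw [h2, h1, ht]
    field_simp
    rw [hBdef]; ring
  rw [hform]
  refine mul_pos (div_pos (D.κ_pos _ _) hB) ?_
  have hm : 0 < b ^ 2 + q ^ 2 := by positivity
  have hsq : (b ^ 2 + q ^ 2) * ((b ^ 2 + 2 * D.g * b * q + (1 + D.g ^ 2) * q ^ 2) * c ^ 2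
      + 2 * D.g * q ^ 2 * c * t + (b ^ 2 + q ^ 2) * t ^ 2 + D.B u y * d) =
      (D.g * q ^ 2 * c + (b ^ 2 + q ^ 2) * t) ^ 2 + (D.B u y * c) ^ 2
        + (b ^ 2 + q ^ 2) * (D.B u y * d) := by
    rw [hBdef]; ring
  refine pos_of_mul_pos_right (a := b ^ 2 + q ^ 2) ?_ hm.le
  rw [hsq]
  rw [hd] at ha
  by_cases hc : c = 0
  · rw [hc] at ha ⊢
    by_cases htz : t = 0
    · have : 0 < d := by rw [htz] at ha; simpa using ha
      positivity
    · simp only [mul_zero, zero_add]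
      positivity
  · positivity

section Metric

lemma partialDeriv_K_sq (hu : u ∈ D.U) (hq : 0 < D.q u y) (j : Fin N) :
    partialDeriv j (fun v => D.K u v ^ 2) y = 2 * D.p u y (EuclideanSpace.single j 1) := by
  refine fderiv_eq_of_hasDerivAt_line
    (differentiableAt_K_sq hu (differentiableAt_const u) differentiableAt_id hq) ?_
  have := hasDerivWithinAt_K_sq (x := fun _ => u) hu (hasDerivWithinAt_const 0 Set.univ u)
    (hasDerivWithinAt_line y (EuclideanSpace.single j 1) Set.univ 0) (by simpa using hq)
  exact this.congr_deriv (by simp [r])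

lemma metricTensor_eq (hu : u ∈ D.U) (hq : 0 < D.q u y) (i j : Fin N) :
    Finsler.metricTensor D.K u y i j =
      D.G u y (EuclideanSpace.single i 1) (EuclideanSpace.single j 1) := by
  have hev : (fun w => partialDeriv j (fun v => D.K u v ^ 2) w) =ᶠ[nhds y]
      fun w => 2 * D.p u w (EuclideanSpace.single j 1) := by
    filter_upwards [eventually_q_pos hu (differentiableAt_const u) differentiableAt_id hq]
      with w hw using partialDeriv_K_sq hu hw.2 j
  have hd := differentiableAt_p hu (differentiableAt_const u)
    (differentiableAt_id (x := y)) hq (EuclideanSpace.single j 1)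
  have h1 : fderiv ℝ (fun w => 2 * D.p u w (EuclideanSpace.single j 1)) y
      (EuclideanSpace.single i 1) =
      2 * D.G u y (EuclideanSpace.single j 1) (EuclideanSpace.single i 1) := by
    refine fderiv_eq_of_hasDerivAt_line (hd.const_mul 2) ?_
    have := hasDerivWithinAt_p (x := fun _ => u) hu (hasDerivWithinAt_const 0 Set.univ u)
      (hasDerivWithinAt_line y (EuclideanSpace.single i 1) Set.univ 0) (by simpa using hq)
      (EuclideanSpace.single j 1)
    exact (this.const_mul 2).congr_deriv (by simp [r, p])
  rw [Finsler.metricTensor, Matrix.of_apply, partialDeriv, hev.fderiv_eq, h1, G_symm hu]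
  ring

/-- `g_ij y^i y^j = K²`. -/
lemma sum_metricTensor_eq (hu : u ∈ D.U) (hq : 0 < D.q u y) :
    ∑ i, ∑ j, Finsler.metricTensor D.K u y i j * y i * y j = D.K u y ^ 2 := by
  rw [← p_self hu, ← G_self hu hq, ← GLin_apply, ← linearMap_sum_coord (D.GLin u y) y,
    LinearMap.sum_apply]
  refine Finset.sum_congr rfl fun i _ => ?_
  rw [LinearMap.smul_apply, ← linearMap_sum_coord (D.GLin u y _) y, smul_eq_mul, Finset.mul_sum]
  refine Finset.sum_congr rfl fun j _ => ?_
  rw [metricTensor_eq hu hq, GLin_apply, smul_eq_mul]; ring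

end Metric

/-! ### The spray and the connection -/

/-- The spray vector: the geodesic spray of `a` corrected by `g k q (y - b w)`. -/
noncomputable def sprayVec (D : LocalFinsleroid N) (u y : RSpace N) : RSpace N :=
  D.Γ u y y + (D.g * D.k u * D.q u y) • (y - D.b u y • D.w u)

/-- The nonlinear connection, half the derivative of the spray vector in the direction `ξ`. -/
noncomputable def conn (D : LocalFinsleroid N) (u y ξ : RSpace N) : RSpace N :=
  D.Γ u ξ y + (D.g * D.k u / 2) • ((D.r u y ξ / D.q u y) • (y - D.b u y • D.w u)
    + D.q u y • (ξ - D.b u ξ • D.w u))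

/-- The Euler–Lagrange equation satisfied by the spray vector. -/
lemma G_sprayVec (hu : u ∈ D.U) (hq : 0 < D.q u y) (z : RSpace N) :
    fderiv ℝ (fun u' => D.p u' y z) u y - 1 / 2 * fderiv ℝ (fun u' => D.K u' y ^ 2) u z =
      D.G u y z (D.sprayVec u y) := by
  have h1 : fderiv ℝ (fun u' => D.p u' y z) u y = _ := fderiv_eq_of_hasDerivAt_line
    (differentiableAt_p hu differentiableAt_id (differentiableAt_const y) hq z)
    (hasDerivWithinAt_p (by simpa using hu) (hasDerivWithinAt_line u y Set.univ 0)
      (hasDerivWithinAt_const 0 Set.univ y) (by simpa using hq) z)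
  have h2 : fderiv ℝ (fun u' => D.K u' y ^ 2) u z = _ := fderiv_eq_of_hasDerivAt_line
    (differentiableAt_K_sq hu differentiableAt_id (differentiableAt_const y) hq)
    (hasDerivWithinAt_K_sq (by simpa using hu) (hasDerivWithinAt_line u z Set.univ 0)
      (hasDerivWithinAt_const 0 Set.univ y) (by simpa using hq))
  rw [h1, h2]
  simp only [zero_smul, add_zero, zero_add]
  rw [D.Γ_symm u hu z y, sprayVec, ← GLin_apply u y z (_ + _), map_add, map_smul, GLin_apply,
    GLin_apply]
  have hB := D.B_pos hq
  have hBdef : D.B u y = D.b u y ^ 2 + D.g * D.b u y * D.q u y + D.q u y ^ 2 := rfl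
  have ha : D.a u y z = D.r u y z + D.b u y * D.b u z := by simp [r]
  have h3 : D.G u y z (y - D.b u y • D.w u) = D.κ u y * (D.r u y z + D.g * D.q u y / D.B u y *
      (D.b u z * D.q u y ^ 2 - D.b u y * D.r u y z)) := by
    have e1 : D.b u (y - D.b u y • D.w u) = 0 := by simp [D.b_w u hu]
    have e2 : D.r u y (y - D.b u y • D.w u) = D.q u y ^ 2 := by
      rw [r_sub_right, r_smul_right, r_w_right hu, q_sq hu]; ring
    have e3 : D.a u z (y - D.b u y • D.w u) = D.r u y z := by
      rw [D.a_symm u hu z]; simp [r, D.a_w u hu]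
    rw [G, e1, e2, e3]
    field_simp
    ring
  rw [h3, ha, r_symm hu z y, ← q_sq hu]
  simp only [smul_eq_mul]
  field_simp
  rw [hBdef]
  ring

lemma metricTensor_eventuallyEq (hu : u ∈ D.U) (hq : 0 < D.q u y) (i j : Fin N) :
    (fun u' => Finsler.metricTensor D.K u' y i j) =ᶠ[nhds u]
      fun u' => D.G u' y (EuclideanSpace.single i 1) (EuclideanSpace.single j 1) := by
  filter_upwards [eventually_q_pos (x := fun u' => u') (y := fun _ => y) hu differentiableAt_id
    (differentiableAt_const y) hq] with u' hu' using metricTensor_eq hu'.1 hu'.2 i j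

/-- The contracted Christoffel symbols of the first kind, as an Euler–Lagrange expression. -/
lemma sum_christoffel_first_kind (hu : u ∈ D.U) (hq : 0 < D.q u y) (l : Fin N) :
    ∑ m, ∑ n, (partialDeriv m (fun u' => Finsler.metricTensor D.K u' y l n) u
      + partialDeriv n (fun u' => Finsler.metricTensor D.K u' y l m) u
      - partialDeriv l (fun u' => Finsler.metricTensor D.K u' y m n) u) * y m * y n =
    2 * fderiv ℝ (fun u' => D.p u' y (EuclideanSpace.single l 1)) u y
      - fderiv ℝ (fun u' => D.K u' y ^ 2) u (EuclideanSpace.single l 1) := by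
  set e : Fin N → RSpace N := fun i => EuclideanSpace.single i 1 with he
  set Φ : Fin N → Fin N → RSpace N →L[ℝ] ℝ := fun i j => fderiv ℝ (fun u' => D.G u' y (e i) (e j)) u
    with hΦ
  have hpd : ∀ m i j, partialDeriv m (fun u' => Finsler.metricTensor D.K u' y i j) u =
      Φ i j (e m) := fun m i j => by
    rw [partialDeriv, (metricTensor_eventuallyEq hu hq i j).fderiv_eq]
  have hev := eventually_q_pos (x := fun u' => u') (y := fun _ => y) hu differentiableAt_id
    (differentiableAt_const y) hq
  have hP : ∀ i, ∑ n, y n • Φ i n = fderiv ℝ (fun u' => D.p u' y (e i)) u := fun i => by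
    have h1 : (fun u' => D.p u' y (e i)) =ᶠ[nhds u] fun u' => ∑ n, y n • D.G u' y (e i) (e n) := by
      filter_upwards [hev] with u' hu'
      rw [← G_self hu'.1 hu'.2, ← GLin_apply, ← linearMap_sum_coord (D.GLin u' y (e i)) y]
      rfl
    have hd : ∀ n, DifferentiableAt ℝ (fun u' => D.G u' y (e i) (e n)) u := fun n =>
      differentiableAt_G hu differentiableAt_id (differentiableAt_const y) hq _ _
    rw [h1.fderiv_eq, fderiv_fun_sum fun n _ => (hd n).fun_const_smul _]
    exact Finset.sum_congr rfl fun n _ => (fderiv_fun_const_smul (hd n) _).symm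
  have hK : ∑ m, y m • fderiv ℝ (fun u' => D.p u' y (e m)) u =
      fderiv ℝ (fun u' => D.K u' y ^ 2) u := by
    have h1 : (fun u' => D.K u' y ^ 2) =ᶠ[nhds u] fun u' => ∑ n, y n • D.p u' y (e n) := by
      filter_upwards [hev] with u' hu'
      rw [← p_self hu'.1, ← pLin_apply, ← linearMap_sum_coord (D.pLin u' y) y]
      rfl
    have hd : ∀ n, DifferentiableAt ℝ (fun u' => D.p u' y (e n)) u := fun n =>
      differentiableAt_p hu differentiableAt_id (differentiableAt_const y) hq _
    rw [h1.fderiv_eq, fderiv_fun_sum fun n _ => (hd n).fun_const_smul _]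
    exact Finset.sum_congr rfl fun n _ => (fderiv_fun_const_smul (hd n) _).symm
  have s1 : ∑ m, ∑ n, Φ l n (e m) * y m * y n = fderiv ℝ (fun u' => D.p u' y (e l)) u y := by
    rw [← hP, ← ContinuousLinearMap.coe_coe, ← linearMap_sum_coord]
    refine Finset.sum_congr rfl fun m _ => ?_
    simp only [ContinuousLinearMap.coe_coe, _root_.sum_apply, smul_eq_mul,
      Finset.mul_sum, _root_.smul_apply]
    exact Finset.sum_congr rfl fun n _ => by ring
  have s2 : ∑ m, ∑ n, Φ l m (e n) * y m * y n = fderiv ℝ (fun u' => D.p u' y (e l)) u y := by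
    rw [← s1, Finset.sum_comm]
    exact Finset.sum_congr rfl fun m _ => Finset.sum_congr rfl fun n _ => by ring
  have s3 : ∑ m, ∑ n, Φ m n (e l) * y m * y n = fderiv ℝ (fun u' => D.K u' y ^ 2) u (e l) := by
    rw [← hK]
    simp only [← hP]
    simp only [_root_.sum_apply, smul_eq_mul, Finset.mul_sum,
      _root_.smul_apply]
    exact Finset.sum_congr rfl fun m _ => Finset.sum_congr rfl fun n _ => by ring
  simp only [hpd, sub_mul, add_mul, Finset.sum_add_distrib, Finset.sum_sub_distrib, s1, s2, s3]
  ring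

lemma spray_eq (hu : u ∈ D.U) (hq : 0 < D.q u y) (i : Fin N) :
    Finsler.spray D.K u y i = D.sprayVec u y i := by
  set m := Finsler.metricTensor D.K u y with hm
  have hunit : IsUnit m.det := isUnit_det_of_pos (D.GLin u y) (fun v hv => G_pos hu hq hv)
    fun i j => metricTensor_eq hu hq i j
  have h1 : Finsler.spray D.K u y i = ∑ l, m⁻¹ i l * (1 / 2 *
      ∑ m, ∑ n, (partialDeriv m (fun u' => Finsler.metricTensor D.K u' y l n) u
      + partialDeriv n (fun u' => Finsler.metricTensor D.K u' y l m) u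
      - partialDeriv l (fun u' => Finsler.metricTensor D.K u' y m n) u) * y m * y n) := by
    simp only [Finsler.spray, Finsler.christoffelSymbol, christoffel, Finset.mul_sum,
      Finset.sum_mul]
    rw [Finset.sum_congr rfl fun m _ => Finset.sum_comm, Finset.sum_comm]
    exact Finset.sum_congr rfl fun l _ => Finset.sum_congr rfl fun m _ =>
      Finset.sum_congr rfl fun n _ => by ring
  have h2 : ∀ l, (1 / 2 *
      ∑ m, ∑ n, (partialDeriv m (fun u' => Finsler.metricTensor D.K u' y l n) u
      + partialDeriv n (fun u' => Finsler.metricTensor D.K u' y l m) u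
      - partialDeriv l (fun u' => Finsler.metricTensor D.K u' y m n) u) * y m * y n) =
      m.mulVec (D.sprayVec u y) l := fun l => by
    have := G_sprayVec hu hq (EuclideanSpace.single l 1)
    rw [sum_christoffel_first_kind hu hq, ← GLin_apply, ← linearMap_sum_coord] at *
    rw [Matrix.mulVec, dotProduct]
    have h3 : ∀ j, m l j * D.sprayVec u y j = D.sprayVec u y j •
      D.GLin u y (EuclideanSpace.single l 1) (EuclideanSpace.single j 1) := fun j => by
      rw [show m l j = _ from metricTensor_eq hu hq l j, GLin_apply, smul_eq_mul, mul_comm]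
    rw [Finset.sum_congr rfl fun j _ => h3 j, ← this]
    ring
  rw [h1, Finset.sum_congr rfl fun l _ => by rw [h2 l]]
  change (m⁻¹.mulVec (m.mulVec (D.sprayVec u y))) i = _
  rw [Matrix.mulVec_mulVec, Matrix.nonsing_inv_mul _ hunit, Matrix.one_mulVec]

lemma hasDerivWithinAt_sprayVec (hu : u ∈ D.U) (hq : 0 < D.q u y) (ξ : RSpace N) :
    HasDerivWithinAt (fun t : ℝ => D.sprayVec u (y + t • ξ)) ((2 : ℝ) • D.conn u y ξ)
      Set.univ 0 := by
  have hy := hasDerivWithinAt_line y ξ Set.univ 0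
  have hx := hasDerivWithinAt_const (0 : ℝ) Set.univ u
  have hq' := hasDerivWithinAt_q (x := fun _ => u) hu hx hy (by simpa using hq)
  have hb := hasDerivWithinAt_b (x := fun _ => u) hu hx hy
  have hΓ : HasDerivWithinAt (fun t : ℝ => D.Γ u (y + t • ξ) (y + t • ξ)) _ Set.univ 0 :=
    HasDerivWithinAt.clm_apply
      ((D.Γ u).hasFDerivAt.comp_hasDerivWithinAt 0 hy) hy
  refine (hΓ.add ((hq'.const_mul (D.g * D.k u)).smul
    (hy.sub (hb.smul_const (D.w u))))).congr_deriv ?_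
  simp only [zero_smul, add_zero, map_zero, _root_.zero_apply, conn, D.Γ_symm u hu y ξ,
    Pi.sub_apply]
  have : D.r u 0 y = 0 := by simp [r]
  rw [this]
  module

lemma connection_eq (hu : u ∈ D.U) (hq : 0 < D.q u y) (i k : Fin N) :
    Finsler.connection D.K u y i k = D.conn u y (EuclideanSpace.single k 1) i := by
  have hev : (fun v => Finsler.spray D.K u v i) =ᶠ[nhds y] fun v => D.sprayVec u v i := by
    filter_upwards [eventually_q_pos hu (differentiableAt_const u) differentiableAt_id hq]
      with w hw using spray_eq hu hw.2 i
  have hd : DifferentiableAt ℝ (fun v => D.sprayVec u v) y := by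
    have h1 := differentiableAt_q hu (differentiableAt_const u) (differentiableAt_id (x := y)) hq
    simp only [id] at h1
    unfold sprayVec
    fun_prop
  have hdi : DifferentiableAt ℝ (fun v => D.sprayVec u v i) y :=
    (EuclideanSpace.proj (𝕜 := ℝ) i).differentiableAt.comp y hd
  have h2 := fderiv_eq_of_hasDerivAt_line hdi
    ((EuclideanSpace.proj (𝕜 := ℝ) i).hasFDerivAt.comp_hasDerivWithinAt 0
      (hasDerivWithinAt_sprayVec hu hq (EuclideanSpace.single k 1)))
  rw [Finsler.connection, partialDeriv, hev.fderiv_eq, h2]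
  simp

/-- The connection as a linear map of the direction. -/
noncomputable def connLin (D : LocalFinsleroid N) (u y : RSpace N) : RSpace N →ₗ[ℝ] RSpace N :=
  { toFun := D.conn u y
    map_add' := fun _ _ => by
      simp only [conn, map_add, _root_.add_apply, r_add_right]; module
    map_smul' := fun _ _ => by
      simp only [conn, map_smul, _root_.smul_apply, r_smul_right, RingHom.id_apply, smul_eq_mul]
      module }

lemma sum_connection_eq (hu : u ∈ D.U) (hq : 0 < D.q u y) (ξ : RSpace N) (i : Fin N) :
    ∑ k, Finsler.connection D.K u y i k * ξ k = D.conn u y ξ i := by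
  have := congrArg (fun v : RSpace N => v i) (linearMap_sum_coord (D.connLin u y) ξ)
  rw [← show D.connLin u y ξ i = D.conn u y ξ i from rfl, ← this]
  simp only [connection_eq hu hq, WithLp.ofLp_sum, Finset.sum_apply, PiLp.smul_apply, smul_eq_mul]
  exact Finset.sum_congr rfl fun k _ => mul_comm _ _

end LocalFinsleroid

/-! ### Conservation of `K` and `λ` under parallel transport -/

namespace LocalFinsleroid

open Finsleroid RSpace

variable {N : ℕ} {D : LocalFinsleroid N}

section Transport

variable {x y y₁ y₂ : ℝ → RSpace N} {ξ : RSpace N} {s : Set ℝ} {t : ℝ}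

lemma neg_conn_add (u y ξ : RSpace N) : -D.conn u y ξ + D.Γ u ξ y =
    -((D.g * D.k u / 2) • ((D.r u y ξ / D.q u y) • (y - D.b u y • D.w u)
    + D.q u y • (ξ - D.b u ξ • D.w u))) := by
  rw [conn]; abel

lemma b_neg_conn_add {u : RSpace N} (hu : u ∈ D.U) (y ξ : RSpace N) :
    D.b u (-D.conn u y ξ + D.Γ u ξ y) = 0 := by
  rw [neg_conn_add]
  simp [D.b_w u hu]

lemma r_neg_conn_add {u : RSpace N} (hu : u ∈ D.U) (y ξ z : RSpace N) :
    D.r u (-D.conn u y ξ + D.Γ u ξ y) z = -(D.g * D.k u / 2 *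
      (D.r u ξ y / D.q u y * D.r u y z + D.q u y * D.r u ξ z)) := by
  rw [neg_conn_add, r_symm hu ξ y]
  simp only [r_neg_left, r_smul_left, r_add_left, r_sub_left, r_w_left hu]; ring

/-- Parallel transport preserves the `b`-component up to the rotation of `b` itself. -/
lemma hasDerivWithinAt_b_parallel (hU : x t ∈ D.U) (hx : HasDerivWithinAt x ξ s t)
    (hy : HasDerivWithinAt y (-D.conn (x t) (y t) ξ) s t) :
    HasDerivWithinAt (fun τ => D.b (x τ) (y τ)) (D.k (x t) * D.r (x t) ξ (y t)) s t :=
  (hasDerivWithinAt_b hU hx hy).congr_deriv (by rw [b_neg_conn_add hU, add_zero])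

lemma hasDerivWithinAt_q_parallel (hU : x t ∈ D.U) (hx : HasDerivWithinAt x ξ s t)
    (hy : HasDerivWithinAt y (-D.conn (x t) (y t) ξ) s t) (hq : 0 < D.q (x t) (y t)) :
    HasDerivWithinAt (fun τ => D.q (x τ) (y τ))
      (-(D.k (x t) * D.r (x t) ξ (y t) * (D.b (x t) (y t) + D.g * D.q (x t) (y t))
        / D.q (x t) (y t))) s t := by
  refine (hasDerivWithinAt_q hU hx hy hq).congr_deriv ?_
  rw [r_symm hU (y t), r_neg_conn_add hU, ← q_sq hU]
  field_simp; ring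

lemma hasDerivWithinAt_r_parallel (hU : x t ∈ D.U) (hx : HasDerivWithinAt x ξ s t)
    (hy₁ : HasDerivWithinAt y₁ (-D.conn (x t) (y₁ t) ξ) s t)
    (hy₂ : HasDerivWithinAt y₂ (-D.conn (x t) (y₂ t) ξ) s t) :
    HasDerivWithinAt (fun τ => D.r (x τ) (y₁ τ) (y₂ τ))
      (-(D.k (x t) * (D.r (x t) ξ (y₁ t) * (D.b (x t) (y₂ t) + D.g / 2 * D.q (x t) (y₂ t)
          + D.g / 2 * D.r (x t) (y₁ t) (y₂ t) / D.q (x t) (y₁ t))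
        + D.r (x t) ξ (y₂ t) * (D.b (x t) (y₁ t) + D.g / 2 * D.q (x t) (y₁ t)
          + D.g / 2 * D.r (x t) (y₁ t) (y₂ t) / D.q (x t) (y₂ t))))) s t := by
  refine (hasDerivWithinAt_r hU hx hy₁ hy₂).congr_deriv ?_
  rw [r_symm hU (y₁ t) (-_ + _), r_neg_conn_add hU, r_neg_conn_add hU, r_symm hU (y₂ t) (y₁ t)]
  ring

/-- `d ln B = -(g k r(dx, y) / q)` along a parallel field. -/
lemma hasDerivWithinAt_B_parallel (hU : x t ∈ D.U) (hx : HasDerivWithinAt x ξ s t)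
    (hy : HasDerivWithinAt y (-D.conn (x t) (y t) ξ) s t) (hq : 0 < D.q (x t) (y t)) :
    HasDerivWithinAt (fun τ => D.B (x τ) (y τ))
      (-(D.g * D.k (x t) * D.r (x t) ξ (y t) / D.q (x t) (y t) * D.B (x t) (y t))) s t := by
  refine (hasDerivWithinAt_quadForm (hasDerivWithinAt_b_parallel hU hx hy)
    (hasDerivWithinAt_q_parallel hU hx hy hq)).congr_deriv ?_
  have hBdef : D.B (x t) (y t) = D.b (x t) (y t) ^ 2 +
    D.g * D.b (x t) (y t) * D.q (x t) (y t) + D.q (x t) (y t) ^ 2 := rfl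
  rw [hBdef]
  field_simp; ring

/-- The metric function is constant along parallel fields. -/
lemma hasDerivWithinAt_K_parallel (hU : x t ∈ D.U) (hx : HasDerivWithinAt x ξ s t)
    (hy : HasDerivWithinAt y (-D.conn (x t) (y t) ξ) s t) (hq : 0 < D.q (x t) (y t)) :
    HasDerivWithinAt (fun τ => D.K (x τ) (y τ)) 0 s t := by
  simp only [K_eq_sqrt]
  have h := hasDerivWithinAt_quadForm_mul_kappa D.g_gt D.g_lt
    (hasDerivWithinAt_b_parallel hU hx hy) (hasDerivWithinAt_q_parallel hU hx hy hq) hq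
  refine (h.sqrt (mul_pos (D.B_pos hq) (D.κ_pos _ _)).ne').congr_deriv ?_
  field_simp
  ring

/-- `λ` is constant along pairs of parallel fields: parallel transport acts on the vectors
`(A, h y_⊥) / √B` by rotations. -/
lemma hasDerivWithinAt_lam_parallel (hU : x t ∈ D.U) (hx : HasDerivWithinAt x ξ s t)
    (hy₁ : HasDerivWithinAt y₁ (-D.conn (x t) (y₁ t) ξ) s t)
    (hy₂ : HasDerivWithinAt y₂ (-D.conn (x t) (y₂ t) ξ) s t)
    (hq₁ : 0 < D.q (x t) (y₁ t)) (hq₂ : 0 < D.q (x t) (y₂ t)) :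
    HasDerivWithinAt (fun τ => D.lam (x τ) (y₁ τ) (y₂ τ)) 0 s t := by
  have hB₁ := D.B_pos hq₁
  have hB₂ := D.B_pos hq₂
  have hs₁ := Real.sqrt_pos.2 hB₁
  have hs₂ := Real.sqrt_pos.2 hB₂
  have dq₁ := hasDerivWithinAt_q_parallel hU hx hy₁ hq₁
  have dq₂ := hasDerivWithinAt_q_parallel hU hx hy₂ hq₂
  have dA₁ := (hasDerivWithinAt_b_parallel hU hx hy₁).add (dq₁.const_mul (D.g / 2))
  have dA₂ := (hasDerivWithinAt_b_parallel hU hx hy₂).add (dq₂.const_mul (D.g / 2))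
  have dr := (hasDerivWithinAt_r_parallel hU hx hy₁ hy₂).const_mul (√(1 - D.g ^ 2 / 4) ^ 2)
  have dB₁ := (hasDerivWithinAt_B_parallel hU hx hy₁ hq₁).sqrt hB₁.ne'
  have dB₂ := (hasDerivWithinAt_B_parallel hU hx hy₂ hq₂).sqrt hB₂.ne'
  refine (((dA₁.mul dA₂).add dr).div (dB₁.mul dB₂) (mul_pos hs₁ hs₂).ne').congr_deriv ?_
  simp only [Pi.add_apply, Pi.mul_apply]
  have e₁ := Real.sq_sqrt hB₁.le
  have e₂ := Real.sq_sqrt hB₂.le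
  rw [Real.sq_sqrt (one_sub_sq_pos D.g_gt D.g_lt).le]
  rw [← e₁, ← e₂, Real.sqrt_sq hs₁.le, Real.sqrt_sq hs₂.le]
  generalize √(D.B (x t) (y₁ t)) = S₁ at *
  generalize √(D.B (x t) (y₂ t)) = S₂ at *
  field_simp
  ring

end Transport

/-! ### The scalar product -/

/-- The scalar product `K₁ K₂ cos α`. -/
noncomputable def scalarProduct (D : LocalFinsleroid N) (u y₁ y₂ : RSpace N) : ℝ :=
  D.K u y₁ * D.K u y₂ * Real.cos (1 / √(1 - D.g ^ 2 / 4) * Real.arccos (D.lam u y₁ y₂))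

/-- The function `s ↦ cos (c arccos s)` is differentiable from the left at `1`, although `arccos`
is not. -/
lemma differentiableWithinAt_cos_mul_arccos (c : ℝ) {s : ℝ} (hs : -1 < s) (hs' : s ≤ 1) :
    DifferentiableWithinAt ℝ (fun s => Real.cos (c * Real.arccos s)) (Set.Iic 1) s := by
  have hlt : ∀ s : ℝ, -1 < s → s < 1 → HasDerivAt (fun s => Real.cos (c * Real.arccos s))
      (c * (Real.sin (c * Real.arccos s) / Real.sin (Real.arccos s))) s := fun s h1 h2 => by
    refine (((Real.hasDerivAt_arccos h1.ne' h2.ne).const_mul c).cos).congr_deriv ?_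
    rw [Real.sin_arccos]; ring
  rcases hs'.lt_or_eq with h | rfl
  · exact (hlt s hs h).differentiableAt.differentiableWithinAt
  have hsin : ∀ c : ℝ, Filter.Tendsto (fun θ => Real.sin (c * θ) / θ) (nhdsWithin 0 {0}ᶜ)
      (nhds c) := fun c => by
    have h1 : HasDerivAt (fun θ : ℝ => Real.sin (c * θ)) c 0 :=
      (((hasDerivAt_id (0 : ℝ)).const_mul c).sin).congr_deriv (by simp)
    have := h1.tendsto_slope
    refine this.congr fun θ => ?_
    simp [slope_def_field]
  have hac : Filter.Tendsto Real.arccos (nhdsWithin 1 (Set.Iio 1)) (nhdsWithin 0 {0}ᶜ) := by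
    refine tendsto_nhdsWithin_iff.2 ⟨?_, ?_⟩
    · have := Real.continuous_arccos.tendsto 1
      rw [Real.arccos_one] at this
      exact this.mono_left nhdsWithin_le_nhds
    · filter_upwards [self_mem_nhdsWithin] with s hs
      exact (Real.arccos_pos.2 hs).ne'
  have hlim : Filter.Tendsto (fun s => deriv (fun s => Real.cos (c * Real.arccos s)) s)
      (nhdsWithin 1 (Set.Iio 1)) (nhds (c * c)) := by
    have h2 := (((hsin c).div (hsin 1) one_ne_zero).comp hac).const_mul c
    rw [div_one] at h2
    refine h2.congr' ?_
    filter_upwards [self_mem_nhdsWithin, nhdsWithin_le_nhds (lt_mem_nhds hs)] with s h3 h4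
    rw [(hlt s h4 h3).deriv]
    have := (Real.arccos_pos.2 h3).ne'
    simp only [Function.comp_apply, Pi.div_apply, one_mul]
    field_simp
  refine (hasDerivWithinAt_Iic_of_tendsto_deriv (s := Set.Ioo (-1) 1) (fun s hs =>
    (hlt s hs.1 hs.2).differentiableAt.differentiableWithinAt) ?_
    (Ioo_mem_nhdsLT hs) hlim).differentiableWithinAt
  exact (Real.continuous_cos.comp (continuous_const.mul
    Real.continuous_arccos)).continuousWithinAt

lemma differentiableAt_scalarProduct {z : RSpace N × RSpace N × RSpace N} (hU : z.1 ∈ D.U)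
    (hq₁ : 0 < D.q z.1 z.2.1) (hq₂ : 0 < D.q z.1 z.2.2) (hlam : D.lam z.1 z.2.1 z.2.2 ≠ -1) :
    DifferentiableAt ℝ (fun z : RSpace N × RSpace N × RSpace N =>
      D.scalarProduct z.1 z.2.1 z.2.2) z := by
  have d0 : DifferentiableAt ℝ (fun z : RSpace N × RSpace N × RSpace N => z.1) z := by fun_prop
  have d1 : DifferentiableAt ℝ (fun z : RSpace N × RSpace N × RSpace N => z.2.1) z := by fun_prop
  have d2 : DifferentiableAt ℝ (fun z : RSpace N × RSpace N × RSpace N => z.2.2) z := by fun_prop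
  refine ((differentiableAt_K hU d0 d1 hq₁).mul (differentiableAt_K hU d0 d2 hq₂)).mul ?_
  have habs := abs_le.1 (abs_lam_le_one hU hq₁ hq₂)
  have hφ := differentiableWithinAt_cos_mul_arccos (1 / √(1 - D.g ^ 2 / 4))
    (lt_of_le_of_ne habs.1 hlam.symm) habs.2
  have hl := differentiableAt_lam hU d0 d1 d2 hq₁ hq₂
  set V := {z : RSpace N × RSpace N × RSpace N | D.lam z.1 z.2.1 z.2.2 ≤ 1} with hV
  have hVn : V ∈ nhds z := by
    filter_upwards [eventually_q_pos hU d0 d1 hq₁, eventually_q_pos hU d0 d2 hq₂] with c h1 h2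
    exact (abs_le.1 (abs_lam_le_one h1.1 h1.2 h2.2)).2
  exact (DifferentiableWithinAt.comp (s := V) z hφ hl.differentiableWithinAt
    fun c hc => hc).differentiableAt hVn

/-- The horizontal derivative of the scalar product vanishes: it is the derivative along a line
whose velocity is horizontal. -/
lemma horizontal_scalarProduct {x y₁ y₂ : RSpace N} (hU : x ∈ D.U)
    (hq₁ : 0 < D.q x y₁) (hq₂ : 0 < D.q x y₂) (hlam : D.lam x y₁ y₂ ≠ -1) (k : Fin N) :
    partialDeriv k (fun u => D.scalarProduct u y₁ y₂) x
      - ∑ n, Finsler.connection D.K x y₁ n k * partialDeriv n (fun v => D.scalarProduct x v y₂) y₁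
      - ∑ n, Finsler.connection D.K x y₂ n k * partialDeriv n (fun v => D.scalarProduct x y₁ v) y₂
      = 0 := by
  have hd := (differentiableAt_scalarProduct (D := D) (z := (x, y₁, y₂)) hU hq₁ hq₂
    hlam).hasFDerivAt
  set L := fderiv ℝ (fun z : RSpace N × RSpace N × RSpace N =>
      D.scalarProduct z.1 z.2.1 z.2.2) (x, y₁, y₂) with hL
  set e : RSpace N := EuclideanSpace.single k 1 with he
  have h0 : HasFDerivAt (fun u => D.scalarProduct u y₁ y₂)
      (L.comp ((ContinuousLinearMap.id ℝ (RSpace N)).prod 0)) x :=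
    HasFDerivAt.comp (f := fun u : RSpace N => (u, y₁, y₂)) x hd
      ((hasFDerivAt_id x).prodMk (hasFDerivAt_const (y₁, y₂) x))
  have h1 : HasFDerivAt (fun v => D.scalarProduct x v y₂)
      (L.comp ((0 : RSpace N →L[ℝ] RSpace N).prod
        ((ContinuousLinearMap.id ℝ (RSpace N)).prod 0))) y₁ :=
    HasFDerivAt.comp (f := fun u : RSpace N => (x, u, y₂)) y₁ hd
      ((hasFDerivAt_const x y₁).prodMk ((hasFDerivAt_id y₁).prodMk (hasFDerivAt_const y₂ y₁)))
  have h2 : HasFDerivAt (fun v => D.scalarProduct x y₁ v)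
      (L.comp ((0 : RSpace N →L[ℝ] RSpace N).prod
        ((0 : RSpace N →L[ℝ] RSpace N).prod (ContinuousLinearMap.id ℝ (RSpace N))))) y₂ :=
    HasFDerivAt.comp (f := fun u : RSpace N => (x, y₁, u)) y₂ hd
      ((hasFDerivAt_const x y₂).prodMk ((hasFDerivAt_const y₁ y₂).prodMk (hasFDerivAt_id y₂)))
  have s1 : ∑ n, Finsler.connection D.K x y₁ n k *
      partialDeriv n (fun v => D.scalarProduct x v y₂) y₁ = L (0, D.conn x y₁ e, 0) := by
    simp only [partialDeriv, h1.fderiv, connection_eq hU hq₁]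
    exact linearMap_sum_coord (L.comp ((0 : RSpace N →L[ℝ] RSpace N).prod
        ((ContinuousLinearMap.id ℝ (RSpace N)).prod 0))).toLinearMap (D.conn x y₁ e)
  have s2 : ∑ n, Finsler.connection D.K x y₂ n k *
      partialDeriv n (fun v => D.scalarProduct x y₁ v) y₂ = L (0, 0, D.conn x y₂ e) := by
    simp only [partialDeriv, h2.fderiv, connection_eq hU hq₂]
    exact linearMap_sum_coord (L.comp ((0 : RSpace N →L[ℝ] RSpace N).prod
        ((0 : RSpace N →L[ℝ] RSpace N).prod
          (ContinuousLinearMap.id ℝ (RSpace N))))).toLinearMap (D.conn x y₂ e)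
  have s0 : partialDeriv k (fun u => D.scalarProduct u y₁ y₂) x = L (e, 0, 0) := by
    rw [partialDeriv, h0.fderiv]; rfl
  rw [s0, s1, s2, ← map_sub, ← map_sub]
  -- the horizontal line through `(x, y₁, y₂)`
  have lx := hasDerivWithinAt_line x e Set.univ 0
  have l1 := hasDerivWithinAt_line y₁ (-D.conn x y₁ e) Set.univ 0
  have l2 := hasDerivWithinAt_line y₂ (-D.conn x y₂ e) Set.univ 0
  have hline : HasFDerivAt (fun z : RSpace N × RSpace N × RSpace N =>
      D.scalarProduct z.1 z.2.1 z.2.2) L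
      (x + (0 : ℝ) • e, y₁ + (0 : ℝ) • -D.conn x y₁ e, y₂ + (0 : ℝ) • -D.conn x y₂ e) := by
    simpa using hd
  have hA := hasDerivWithinAt_univ.1
    (hline.comp_hasDerivWithinAt (0 : ℝ) (lx.prodMk (l1.prodMk l2)))
  have hK₁ := hasDerivWithinAt_K_parallel (D := D) (x := fun τ : ℝ => x + τ • e)
    (y := fun τ : ℝ => y₁ + τ • -D.conn x y₁ e) (t := 0) (by simpa using hU) lx
    (by simpa using l1) (by simpa using hq₁)
  have hK₂ := hasDerivWithinAt_K_parallel (D := D) (x := fun τ : ℝ => x + τ • e)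
    (y := fun τ : ℝ => y₂ + τ • -D.conn x y₂ e) (t := 0) (by simpa using hU) lx
    (by simpa using l2) (by simpa using hq₂)
  have hlm := hasDerivWithinAt_lam_parallel (D := D) (x := fun τ : ℝ => x + τ • e)
    (y₁ := fun τ : ℝ => y₁ + τ • -D.conn x y₁ e) (y₂ := fun τ : ℝ => y₂ + τ • -D.conn x y₂ e)
    (t := 0) (by simpa using hU) lx
    (by simpa using l1) (by simpa using l2) (by simpa using hq₁) (by simpa using hq₂)
  have habs := abs_le.1 (abs_lam_le_one hU hq₁ hq₂)
  have hφ := (differentiableWithinAt_cos_mul_arccos (1 / √(1 - D.g ^ 2 / 4))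
    (lt_of_le_of_ne habs.1 hlam.symm) habs.2).hasDerivWithinAt
  rw [show D.lam x y₁ y₂ = D.lam (x + (0 : ℝ) • e) (y₁ + (0 : ℝ) • -D.conn x y₁ e)
    (y₂ + (0 : ℝ) • -D.conn x y₂ e) by simp] at hφ
  have hB : HasDerivAt (fun τ : ℝ => D.scalarProduct (x + τ • e) (y₁ + τ • -D.conn x y₁ e)
      (y₂ + τ • -D.conn x y₂ e)) 0 0 := by
    set V := {τ : ℝ | D.lam (x + τ • e) (y₁ + τ • -D.conn x y₁ e)
      (y₂ + τ • -D.conn x y₂ e) ≤ 1} with hV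
    have hVn : V ∈ nhds 0 := by
      filter_upwards [eventually_q_pos (D := D) (x := fun τ : ℝ => x + τ • e)
        (y := fun τ : ℝ => y₁ + τ • -D.conn x y₁ e) (z := 0) (by simpa using hU) (by fun_prop)
        (by fun_prop) (by simpa using hq₁), eventually_q_pos (D := D)
        (x := fun τ : ℝ => x + τ • e) (y := fun τ : ℝ => y₂ + τ • -D.conn x y₂ e) (z := 0)
        (by simpa using hU) (by fun_prop) (by fun_prop) (by simpa using hq₂)] with τ h1 h2
      exact (abs_le.1 (abs_lam_le_one h1.1 h1.2 h2.2)).2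
    have hc := HasDerivWithinAt.comp (h := fun τ : ℝ => D.lam (x + τ • e)
      (y₁ + τ • -D.conn x y₁ e) (y₂ + τ • -D.conn x y₂ e)) (s := V) (0 : ℝ) hφ
      (hlm.mono (Set.subset_univ V)) fun c hc => hc
    exact (((hK₁.mul hK₂).hasDerivAt Filter.univ_mem).mul (hc.hasDerivAt hVn)).congr_deriv (by simp)
  have := hA.unique hB
  simpa [sub_eq_add_neg] using this

end LocalFinsleroid

/-! ### The Levi-Civita connection in coordinates -/

namespace RSpace

variable {N : ℕ}

lemma linearMap_ext {V : Type*} [AddCommGroup V] [Module ℝ V] {L L' : RSpace N →ₗ[ℝ] V}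
    (h : ∀ i, L (EuclideanSpace.single i 1) = L' (EuclideanSpace.single i 1)) (v : RSpace N) :
    L v = L' v := by
  rw [← linearMap_sum_coord L, ← linearMap_sum_coord L']
  exact Finset.sum_congr rfl fun i _ => by rw [h]

/-- The bilinear map with the Christoffel symbols as components. -/
noncomputable def christoffelMap (m : RSpace N → Matrix (Fin N) (Fin N) ℝ) (u : RSpace N) :
    RSpace N →L[ℝ] RSpace N →L[ℝ] RSpace N :=
  ∑ i, ∑ j, ∑ k, christoffel m u i j k • (EuclideanSpace.proj (𝕜 := ℝ) j).smulRight
    ((EuclideanSpace.proj (𝕜 := ℝ) k : RSpace N →L[ℝ] ℝ).smulRight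
      (EuclideanSpace.single i (1 : ℝ) : RSpace N))

lemma christoffelMap_single (m : RSpace N → Matrix (Fin N) (Fin N) ℝ) (u : RSpace N)
    (j k : Fin N) :
    christoffelMap m u (EuclideanSpace.single j 1) (EuclideanSpace.single k 1) =
      ∑ i, christoffel m u i j k • EuclideanSpace.single i (1 : ℝ) := by
  simp [christoffelMap, _root_.sum_apply, _root_.smul_apply, ite_smul]

variable {a : RSpace N → RSpace N →L[ℝ] RSpace N →L[ℝ] ℝ} {u : RSpace N}

/-- The components of a field of bilinear forms. -/
noncomputable def components (a : RSpace N → RSpace N →L[ℝ] RSpace N →L[ℝ] ℝ) (u : RSpace N) :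
    Matrix (Fin N) (Fin N) ℝ :=
  Matrix.of fun i j => a u (EuclideanSpace.single i 1) (EuclideanSpace.single j 1)

lemma partialDeriv_components (ha : DifferentiableAt ℝ a u) (l i j : Fin N) :
    partialDeriv l (fun w => components a w i j) u =
      fderiv ℝ a u (EuclideanSpace.single l 1) (EuclideanSpace.single i 1)
        (EuclideanSpace.single j 1) := by
  have h1 : HasFDerivAt a (fderiv ℝ a u) u := ha.hasFDerivAt
  have h2 := h1.clm_apply (hasFDerivAt_const (EuclideanSpace.single i (1 : ℝ) : RSpace N) u)
  have h3 := h2.clm_apply (hasFDerivAt_const (EuclideanSpace.single j (1 : ℝ) : RSpace N) u)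
  change fderiv ℝ (fun w => a w (EuclideanSpace.single i 1) (EuclideanSpace.single j 1)) u _ = _
  rw [h3.fderiv]
  simp

/-- Koszul's formula on coordinate vector fields. -/
lemma apply_christoffelMap_single (hpos : ∀ v, v ≠ 0 → 0 < a u v v)
    (hsymm : ∀ v z, a u v z = a u z v) (j k l : Fin N) :
    a u (christoffelMap (components a) u (EuclideanSpace.single j 1) (EuclideanSpace.single k 1))
      (EuclideanSpace.single l 1) =
    1 / 2 * (partialDeriv j (fun w => components a w l k) u
      + partialDeriv k (fun w => components a w l j) u
      - partialDeriv l (fun w => components a w j k) u) := by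
  have hunit : IsUnit (components a u).det := isUnit_det_of_pos
    (ContinuousLinearMap.toLinearMap₁₂ (a u)) (fun v hv => hpos v hv) fun i j => rfl
  set R : Fin N → ℝ := fun l => partialDeriv j (fun w => components a w l k) u
      + partialDeriv k (fun w => components a w l j) u
      - partialDeriv l (fun w => components a w j k) u with hR
  have h1 : ∀ i, christoffel (components a) u i j k =
      1 / 2 * ((components a u)⁻¹.mulVec R) i := fun i => rfl
  have h2 : (components a u).mulVec ((components a u)⁻¹.mulVec R) l = R l := by
    rw [Matrix.mulVec_mulVec, Matrix.mul_nonsing_inv _ hunit, Matrix.one_mulVec]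
  rw [christoffelMap_single, map_sum, _root_.sum_apply]
  change _ = 1 / 2 * R l
  rw [← h2, Matrix.mulVec, dotProduct, Finset.mul_sum]
  refine Finset.sum_congr rfl fun i _ => ?_
  rw [map_smul, _root_.smul_apply, h1, smul_eq_mul, components, Matrix.of_apply,
    hsymm (EuclideanSpace.single l 1)]
  ring

lemma christoffelMap_symm (hsymm : ∀ᶠ w in nhds u, ∀ v z, a w v z = a w z v) (v z : RSpace N) :
    christoffelMap (components a) u v z = christoffelMap (components a) u z v := by
  have hc : ∀ i j k, christoffel (components a) u i j k = christoffel (components a) u i k j := by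
    intro i j k
    simp only [christoffel]
    congr 1
    refine Finset.sum_congr rfl fun l _ => ?_
    have : partialDeriv l (fun w => components a w j k) u =
        partialDeriv l (fun w => components a w k j) u := by
      have hev : (fun w => components a w j k) =ᶠ[nhds u] fun w => components a w k j := by
        filter_upwards [hsymm] with w hw using hw _ _
      rw [partialDeriv, hev.fderiv_eq, partialDeriv]
    rw [this]; ring
  have h1 : ∀ j k, christoffelMap (components a) u (EuclideanSpace.single j 1)
      (EuclideanSpace.single k 1) = christoffelMap (components a) u (EuclideanSpace.single k 1)
      (EuclideanSpace.single j 1) := fun j k => by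
    simp only [christoffelMap_single, hc _ j k]
  have h2 : ∀ j z, christoffelMap (components a) u (EuclideanSpace.single j 1) z =
      christoffelMap (components a) u z (EuclideanSpace.single j 1) := fun j z =>
    linearMap_ext (L := (christoffelMap (components a) u (EuclideanSpace.single j 1)).toLinearMap)
      (L' := ((christoffelMap (components a) u).flip (EuclideanSpace.single j 1)).toLinearMap)
      (h1 j) z
  exact linearMap_ext (L := ((christoffelMap (components a) u).flip z).toLinearMap)
    (L' := (christoffelMap (components a) u z).toLinearMap) (fun j => h2 j z) v

lemma fderiv_eq_christoffelMap (ha : DifferentiableAt ℝ a u)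
    (hsymm : ∀ᶠ w in nhds u, ∀ v z, a w v z = a w z v) (hpos : ∀ v, v ≠ 0 → 0 < a u v v)
    (ξ v z : RSpace N) :
    fderiv ℝ a u ξ v z = a u (christoffelMap (components a) u ξ v) z
      + a u v (christoffelMap (components a) u ξ z) := by
  have hs := hsymm.self_of_nhds
  have hd : ∀ l i j, partialDeriv l (fun w => components a w i j) u =
        partialDeriv l (fun w => components a w j i) u := fun l i j => by
    have hev : (fun w => components a w i j) =ᶠ[nhds u] fun w => components a w j i := by
      filter_upwards [hsymm] with w hw using hw _ _
    rw [partialDeriv, hev.fderiv_eq, partialDeriv]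
  set Γ := christoffelMap (components a) u with hΓ
  have h0 : ∀ l i j, fderiv ℝ a u (EuclideanSpace.single l 1) (EuclideanSpace.single i 1)
      (EuclideanSpace.single j 1) =
      a u (Γ (EuclideanSpace.single l 1) (EuclideanSpace.single i 1)) (EuclideanSpace.single j 1)
      + a u (Γ (EuclideanSpace.single l 1) (EuclideanSpace.single j 1))
        (EuclideanSpace.single i 1) := fun l i j => by
    rw [← partialDeriv_components ha, hΓ, apply_christoffelMap_single hpos hs,
      apply_christoffelMap_single hpos hs, hd _ j i, hd _ l i, hd _ j l]
    ring
  rw [hs v]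
  have h1 : ∀ l i z, fderiv ℝ a u (EuclideanSpace.single l 1) (EuclideanSpace.single i 1) z =
      a u (Γ (EuclideanSpace.single l 1) (EuclideanSpace.single i 1)) z
      + a u (Γ (EuclideanSpace.single l 1) z) (EuclideanSpace.single i 1) := fun l i z =>
    linearMap_ext (L := (fderiv ℝ a u (EuclideanSpace.single l 1)
        (EuclideanSpace.single i 1)).toLinearMap)
      (L' := (a u (Γ (EuclideanSpace.single l 1) (EuclideanSpace.single i 1))
        + ((a u).flip (EuclideanSpace.single i 1)).comp
          (Γ (EuclideanSpace.single l 1))).toLinearMap) (h0 l i) z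
  have h2 : ∀ l v z, fderiv ℝ a u (EuclideanSpace.single l 1) v z =
      a u (Γ (EuclideanSpace.single l 1) v) z
      + a u (Γ (EuclideanSpace.single l 1) z) v := fun l v z =>
    linearMap_ext (L := ((fderiv ℝ a u (EuclideanSpace.single l 1)).flip z).toLinearMap)
      (L' := (((a u).flip z).comp (Γ (EuclideanSpace.single l 1))
        + a u (Γ (EuclideanSpace.single l 1) z)).toLinearMap) (fun i => h1 l i z) v
  exact linearMap_ext (L := (((fderiv ℝ a u).flip v).flip z).toLinearMap)
      (L' := (((a u).flip z).comp (Γ.flip v)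
        + ((a u).flip v).comp (Γ.flip z)).toLinearMap) (fun l => h2 l v z) ξ

end RSpace

/-! ### Local coordinates on the manifold -/

namespace FinsleroidSpace

open RSpace

section Charts

variable {N : ℕ} {M : Type*} [TopologicalSpace M] [ChartedSpace (RSpace N) M]
  {e e₁ e₂ : OpenPartialHomeomorph M (RSpace N)}

/-- The differential of the inverse chart, as a map to the model space. -/
noncomputable def chartDeriv (e : OpenPartialHomeomorph M (RSpace N)) (u : RSpace N) :
    RSpace N →L[ℝ] RSpace N :=
  mfderiv 𝓘(ℝ, RSpace N) 𝓘(ℝ, RSpace N) e.symm u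

lemma mdifferentiable_of_mem_maximalAtlas
    (he : e ∈ IsManifold.maximalAtlas 𝓘(ℝ, RSpace N) ∞ M) :
    e.MDifferentiable 𝓘(ℝ, RSpace N) 𝓘(ℝ, RSpace N) :=
  ⟨(contMDiffOn_of_mem_maximalAtlas he).mdifferentiableOn (by simp),
    (contMDiffOn_symm_of_mem_maximalAtlas he).mdifferentiableOn (by simp)⟩

lemma ofCoord_bijective (he : e ∈ IsManifold.maximalAtlas 𝓘(ℝ, RSpace N) ∞ M) {u : RSpace N}
    (hu : u ∈ e.target) : Function.Bijective (ofCoord e u) :=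
  (mdifferentiable_of_mem_maximalAtlas he).symm.mfderiv_bijective hu

lemma ofCoord_ne_zero (he : e ∈ IsManifold.maximalAtlas 𝓘(ℝ, RSpace N) ∞ M) {u : RSpace N}
    (hu : u ∈ e.target) {v : RSpace N} (hv : v ≠ 0) : ofCoord e u v ≠ 0 := fun h =>
  hv ((ofCoord_bijective he hu).1 (h.trans (map_zero (chartDeriv e u)).symm))

lemma ofCoord_toCoord (he : e ∈ IsManifold.maximalAtlas 𝓘(ℝ, RSpace N) ∞ M) {p : M}
    (hp : p ∈ e.source) (y : TangentSpace 𝓘(ℝ, RSpace N) p) :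
    (ofCoord e (e p) (toCoord e y) : RSpace N) = y :=
  DFunLike.congr_fun ((mdifferentiable_of_mem_maximalAtlas he).symm_comp_deriv hp) y

/-- Functions of a tangent vector may be computed from its components in a chart. The vector with
given components at `e.symm (e p)` and the original vector at `p` live in tangent spaces which
agree only propositionally, so that the point is moved by substitution. -/
lemma apply_ofCoord_toCoord {β : Type*} (f : ∀ p : M, TangentSpace 𝓘(ℝ, RSpace N) p → β)
    (he : e ∈ IsManifold.maximalAtlas 𝓘(ℝ, RSpace N) ∞ M) {p : M}
    (hp : p ∈ e.source) (y : TangentSpace 𝓘(ℝ, RSpace N) p) :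
    f (e.symm (e p)) (ofCoord e (e p) (toCoord e y)) = f p y := by
  have h1 : ∀ p' : M, p' = p → f p' (show RSpace N from y) = f p y := fun p' h => by
    subst h; rfl
  refine Eq.trans ?_ (h1 _ (e.left_inv hp))
  exact congrArg (fun v : RSpace N => f (e.symm (e p)) v) (ofCoord_toCoord he hp y)

lemma apply₂_ofCoord_toCoord {β : Type*}
    (f : ∀ p : M, TangentSpace 𝓘(ℝ, RSpace N) p → TangentSpace 𝓘(ℝ, RSpace N) p → β)
    (he : e ∈ IsManifold.maximalAtlas 𝓘(ℝ, RSpace N) ∞ M) {p : M}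
    (hp : p ∈ e.source) (y z : TangentSpace 𝓘(ℝ, RSpace N) p) :
    f (e.symm (e p)) (ofCoord e (e p) (toCoord e y)) (ofCoord e (e p) (toCoord e z)) =
      f p y z := by
  have h1 : ∀ p' : M, p' = p → f p' (show RSpace N from y) (show RSpace N from z) = f p y z :=
    fun p' h => by subst h; rfl
  refine Eq.trans ?_ (h1 _ (e.left_inv hp))
  exact congrArg₂ (fun v w : RSpace N => f (e.symm (e p)) v w) (ofCoord_toCoord he hp y)
    (ofCoord_toCoord he hp z)

lemma toCoord_ofCoord (he₁ : e₁ ∈ IsManifold.maximalAtlas 𝓘(ℝ, RSpace N) ∞ M)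
    (he₂ : e₂ ∈ IsManifold.maximalAtlas 𝓘(ℝ, RSpace N) ∞ M) {u : RSpace N}
    (hu : u ∈ e₁.target) (hu' : e₁.symm u ∈ e₂.source) (v : RSpace N) :
    toCoord e₂ (ofCoord e₁ u v) = fderiv ℝ (e₂ ∘ e₁.symm) u v := by
  rw [← mfderiv_eq_fderiv, mfderiv_comp (I' := 𝓘(ℝ, RSpace N)) u
    ((mdifferentiable_of_mem_maximalAtlas he₂).mdifferentiableAt hu')
    ((mdifferentiable_of_mem_maximalAtlas he₁).mdifferentiableAt_symm hu)]
  rfl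

lemma fderiv_transition_toCoord (he₁ : e₁ ∈ IsManifold.maximalAtlas 𝓘(ℝ, RSpace N) ∞ M)
    (he₂ : e₂ ∈ IsManifold.maximalAtlas 𝓘(ℝ, RSpace N) ∞ M) {p : M}
    (hp₁ : p ∈ e₁.source) (hp₂ : p ∈ e₂.source) (y : TangentSpace 𝓘(ℝ, RSpace N) p) :
    fderiv ℝ (e₂ ∘ e₁.symm) (e₁ p) (toCoord e₁ y) = toCoord e₂ y := by
  rw [← toCoord_ofCoord he₁ he₂ (e₁.map_source hp₁) (by rwa [e₁.left_inv hp₁])]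
  exact apply_ofCoord_toCoord (fun p y => (toCoord e₂ (p := p) y : RSpace N)) he₁ hp₁ y

end Charts

variable {N : ℕ} {M : Type*} [TopologicalSpace M] [ChartedSpace (RSpace N) M]
  [IsManifold 𝓘(ℝ, RSpace N) ∞ M] (F : FinsleroidSpace N M)
  (e : OpenPartialHomeomorph M (RSpace N))

/-- The Riemannian metric in the chart `e`. -/
noncomputable def aForm (u : RSpace N) : RSpace N →L[ℝ] RSpace N →L[ℝ] ℝ :=
  ContinuousLinearMap.bilinearComp (E := RSpace N) (F := RSpace N)
    (show RSpace N →L[ℝ] RSpace N →L[ℝ] ℝ from F.a.inner (e.symm u))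
    (chartDeriv e u) (chartDeriv e u)

/-- The axis 1-form in the chart `e`. -/
noncomputable def bForm (u : RSpace N) : RSpace N →L[ℝ] ℝ :=
  (show RSpace N →L[ℝ] ℝ from F.b (e.symm u)).comp (chartDeriv e u)

variable {e}

lemma contMDiffAt_ofCoord (he : e ∈ IsManifold.maximalAtlas 𝓘(ℝ, RSpace N) ∞ M) {u : RSpace N}
    (hu : u ∈ e.target) (v : RSpace N) :
    ContMDiffAt 𝓘(ℝ, RSpace N) (𝓘(ℝ, RSpace N).prod 𝓘(ℝ, RSpace N)) ∞
      (fun u => Bundle.TotalSpace.mk' (RSpace N)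
        (E := fun p : M => TangentSpace 𝓘(ℝ, RSpace N) p) (e.symm u) (ofCoord e u v)) u := by
  have h1 := (contMDiffOn_symm_of_mem_maximalAtlas he).contMDiffOn_tangentMapWithin
    (m := ∞) (by simp) e.open_target.uniqueMDiffOn
  have h2 : ContMDiffAt 𝓘(ℝ, RSpace N) (𝓘(ℝ, RSpace N).prod 𝓘(ℝ, RSpace N)) ∞
      (fun u => (⟨u, v⟩ : TangentBundle 𝓘(ℝ, RSpace N) (RSpace N))) u :=
    contMDiffAt_vectorSpace_iff_contDiffAt.2 contDiffAt_const
  have h3 := (h1 ⟨u, v⟩ hu).comp (s := e.target) u h2.contMDiffWithinAt fun w hw => hw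
  refine (h3.contMDiffAt (e.open_target.mem_nhds hu)).congr_of_eventuallyEq ?_
  filter_upwards [e.open_target.mem_nhds hu] with w hw
  exact (tangentMapWithin_eq_tangentMap (p := ⟨w, v⟩) (e.open_target.uniqueMDiffOn w hw)
    ((mdifferentiable_of_mem_maximalAtlas he).mdifferentiableAt_symm hw)).symm

lemma differentiableAt_aForm (he : e ∈ IsManifold.maximalAtlas 𝓘(ℝ, RSpace N) ∞ M)
    {u : RSpace N} (hu : u ∈ e.target) : DifferentiableAt ℝ (F.aForm e) u := by
  have h : ContDiffOn ℝ ∞ (F.aForm e) e.target := by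
    refine contDiffOn_clm_apply.2 fun v => contDiffOn_clm_apply.2 fun z x hx => ?_
    have h1 := (F.a.contMDiff (e.symm x)).comp x
      ((contMDiffOn_symm_of_mem_maximalAtlas he).contMDiffAt (e.open_target.mem_nhds hx))
    have h2 := ContMDiffAt.clm_bundle_apply₂ (F₁ := RSpace N) (F₂ := RSpace N) (F₃ := ℝ)
      (E₃ := Bundle.Trivial M ℝ) h1 (contMDiffAt_ofCoord he hx v) (contMDiffAt_ofCoord he hx z)
    simp only [Bundle.contMDiffAt_totalSpace] at h2
    exact (contMDiffAt_iff_contDiffAt.1 h2.2).contDiffWithinAt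
  exact (h.contDiffAt (e.open_target.mem_nhds hu)).differentiableAt (by simp)

lemma differentiableAt_bForm (he : e ∈ IsManifold.maximalAtlas 𝓘(ℝ, RSpace N) ∞ M)
    {u : RSpace N} (hu : u ∈ e.target) : DifferentiableAt ℝ (F.bForm e) u := by
  have h : ContDiffOn ℝ ∞ (F.bForm e) e.target := by
    refine contDiffOn_clm_apply.2 fun v x hx => ?_
    have h1 := (F.smooth_b (e.symm x)).comp x
      ((contMDiffOn_symm_of_mem_maximalAtlas he).contMDiffAt (e.open_target.mem_nhds hx))
    have h2 := ContMDiffAt.clm_bundle_apply (F₁ := RSpace N) (F₂ := ℝ)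
      (E₂ := Bundle.Trivial M ℝ) h1 (contMDiffAt_ofCoord he hx v)
    simp only [Bundle.contMDiffAt_totalSpace] at h2
    exact (contMDiffAt_iff_contDiffAt.1 h2.2).contDiffWithinAt
  exact (h.contDiffAt (e.open_target.mem_nhds hu)).differentiableAt (by simp)

lemma aForm_symm (u v z : RSpace N) : F.aForm e u v z = F.aForm e u z v :=
  F.a.symm (e.symm u) (ofCoord e u v) (ofCoord e u z)

lemma aForm_pos (he : e ∈ IsManifold.maximalAtlas 𝓘(ℝ, RSpace N) ∞ M) {u : RSpace N}
    (hu : u ∈ e.target) {v : RSpace N} (hv : v ≠ 0) : 0 < F.aForm e u v v :=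
  F.a.pos (e.symm u) (ofCoord e u v) (ofCoord_ne_zero he hu hv)

lemma exists_dual_bForm (he : e ∈ IsManifold.maximalAtlas 𝓘(ℝ, RSpace N) ∞ M) {u : RSpace N}
    (hu : u ∈ e.target) : ∃ w, (∀ v, F.aForm e u w v = F.bForm e u v) ∧ F.bForm e u w = 1 := by
  obtain ⟨w, hw, hw1⟩ := F.unit_b (e.symm u)
  obtain ⟨w', rfl⟩ := (ofCoord_bijective he hu).2 w
  exact ⟨w', fun v => hw _, (hw _).symm.trans hw1⟩

lemma fderiv_bForm (he : e ∈ IsManifold.maximalAtlas 𝓘(ℝ, RSpace N) ∞ M) {k₀ : ℝ} {u : RSpace N}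
    (hu : u ∈ e.target) (h : ∀ i j, F.nablaB e u i j =
      k₀ * (F.aCoord e u i j - F.bCoord e u i * F.bCoord e u j)) (ξ v : RSpace N) :
    fderiv ℝ (F.bForm e) u ξ v = k₀ * (F.aForm e u ξ v - F.bForm e u ξ * F.bForm e u v)
      + F.bForm e u (christoffelMap (components (F.aForm e)) u ξ v) := by
  have h0 : ∀ i j, fderiv ℝ (F.bForm e) u (EuclideanSpace.single i 1) (EuclideanSpace.single j 1) =
      k₀ * (F.aForm e u (EuclideanSpace.single i 1) (EuclideanSpace.single j 1)
        - F.bForm e u (EuclideanSpace.single i 1) * F.bForm e u (EuclideanSpace.single j 1))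
      + F.bForm e u (christoffelMap (components (F.aForm e)) u (EuclideanSpace.single i 1)
        (EuclideanSpace.single j 1)) := fun i j => by
    have h1 := (differentiableAt_bForm F he hu).hasFDerivAt.clm_apply
      (hasFDerivAt_const (EuclideanSpace.single j (1 : ℝ) : RSpace N) u)
    have h2 : partialDeriv i (fun w => F.bCoord e w j) u = fderiv ℝ (F.bForm e) u
        (EuclideanSpace.single i 1) (EuclideanSpace.single j 1) := by
      change fderiv ℝ (fun w => F.bForm e w (EuclideanSpace.single j 1)) u _ = _
      rw [h1.fderiv]
      simp
    have h3 : F.bForm e u (christoffelMap (components (F.aForm e)) u (EuclideanSpace.single i 1)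
        (EuclideanSpace.single j 1)) = ∑ l, christoffel (F.aCoord e) u l i j * F.bCoord e u l := by
      rw [christoffelMap_single, map_sum]
      exact Finset.sum_congr rfl fun l _ => map_smul _ _ _
    have h4 := h i j
    rw [nablaB, h2, ← h3, sub_eq_iff_eq_add] at h4
    exact h4
  have h1 : ∀ i v, fderiv ℝ (F.bForm e) u (EuclideanSpace.single i 1) v =
      k₀ * (F.aForm e u (EuclideanSpace.single i 1) v
        - F.bForm e u (EuclideanSpace.single i 1) * F.bForm e u v)
      + F.bForm e u (christoffelMap (components (F.aForm e)) u (EuclideanSpace.single i 1) v) :=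
    fun i v => linearMap_ext
      (L := (fderiv ℝ (F.bForm e) u (EuclideanSpace.single i 1)).toLinearMap)
      (L' := (k₀ • (F.aForm e u (EuclideanSpace.single i 1)
        - F.bForm e u (EuclideanSpace.single i 1) • F.bForm e u)
        + (F.bForm e u).comp (christoffelMap (components (F.aForm e)) u
          (EuclideanSpace.single i 1))).toLinearMap) (h0 i) v
  have h2 := linearMap_ext
      (L := ((fderiv ℝ (F.bForm e) u).flip v).toLinearMap)
      (L' := (k₀ • ((F.aForm e u).flip v - F.bForm e u v • F.bForm e u)
        + (F.bForm e u).comp ((christoffelMap (components (F.aForm e)) u).flip v)).toLinearMap)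
      (fun i => (h1 i v).trans (by simp [mul_comm])) ξ
  exact h2.trans (by simp [mul_comm])

/-- The local data of a Finsleroid space of Landsberg type in a chart. -/
noncomputable def localData (he : e ∈ IsManifold.maximalAtlas 𝓘(ℝ, RSpace N) ∞ M) (k : M → ℝ)
    (hk : ∀ u ∈ e.target, ∀ i j, F.nablaB e u i j =
      k (e.symm u) * (F.aCoord e u i j - F.bCoord e u i * F.bCoord e u j)) :
    LocalFinsleroid N where
  U := e.target
  isOpen_U := e.open_target
  a := F.aForm e
  b := F.bForm e
  w u := by
    classical
    exact if hu : u ∈ e.target then (F.exists_dual_bForm he hu).choose else 0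
  Γ := christoffelMap (components (F.aForm e))
  k u := k (e.symm u)
  g := F.g
  g_gt := F.g_gt
  g_lt := F.g_lt
  diff_a _ hu := F.differentiableAt_aForm he hu
  diff_b _ hu := F.differentiableAt_bForm he hu
  a_symm u _ v z := F.aForm_symm u v z
  a_pos _ hu _ hv := F.aForm_pos he hu hv
  a_w u hu v := by
    rw [dif_pos hu]
    exact (F.exists_dual_bForm he hu).choose_spec.1 v
  b_w u hu := by
    rw [dif_pos hu]
    exact (F.exists_dual_bForm he hu).choose_spec.2
  Γ_symm _ _ v z := christoffelMap_symm (Filter.Eventually.of_forall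
    fun u v z => F.aForm_symm u v z) v z
  fderiv_a _ hu ξ v z := fderiv_eq_christoffelMap (F.differentiableAt_aForm he hu)
    (Filter.Eventually.of_forall fun u v z => F.aForm_symm u v z)
    (fun _ hv => F.aForm_pos he hu hv) ξ v z
  fderiv_b _ hu ξ v := F.fderiv_bForm he hu (hk _ hu) ξ v

lemma localData_K (he : e ∈ IsManifold.maximalAtlas 𝓘(ℝ, RSpace N) ∞ M) (k : M → ℝ)
    (hk : ∀ u ∈ e.target, ∀ i j, F.nablaB e u i j =
      k (e.symm u) * (F.aCoord e u i j - F.bCoord e u i * F.bCoord e u j)) :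
    (F.localData he k hk).K = F.KCoord e := rfl

end FinsleroidSpace

/-! ### Change of coordinates -/

namespace LocalFinsleroid

variable {N : ℕ}

/-- `φ` is a change of coordinates near `x` carrying the data `D₁` to the data `D₂`. -/
structure IsTransition (D₁ D₂ : LocalFinsleroid N) (φ : RSpace N → RSpace N) (x : RSpace N) :
    Prop where
  mem : x ∈ D₁.U
  map_mem : φ x ∈ D₂.U
  contDiffAt : ContDiffAt ℝ ∞ φ x
  surjective : Function.Surjective (fderiv ℝ φ x)
  a_eq : ∀ᶠ u in nhds x, ∀ v z, D₁.a u v z = D₂.a (φ u) (fderiv ℝ φ u v) (fderiv ℝ φ u z)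
  b_eq : ∀ v, D₁.b x v = D₂.b (φ x) (fderiv ℝ φ x v)
  k_eq : D₁.k x = D₂.k (φ x)
  g_eq : D₁.g = D₂.g

namespace IsTransition

variable {D₁ D₂ : LocalFinsleroid N} {φ : RSpace N → RSpace N} {x : RSpace N}
  (h : IsTransition D₁ D₂ φ x)

include h

lemma hasFDerivAt : HasFDerivAt φ (fderiv ℝ φ x) x :=
  (h.contDiffAt.differentiableAt (by simp)).hasFDerivAt

lemma hasFDerivAt_fderiv : HasFDerivAt (fderiv ℝ φ) (fderiv ℝ (fderiv ℝ φ) x) x :=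
  ((h.contDiffAt.fderiv_right (m := 1) (by norm_cast)).differentiableAt (by simp)).hasFDerivAt

lemma eq_of_forall_a_eq {v z : RSpace N}
    (hv : ∀ y, D₂.a (φ x) v (fderiv ℝ φ x y) = D₂.a (φ x) z (fderiv ℝ φ x y)) : v = z := by
  by_contra hne
  obtain ⟨y, hy⟩ := h.surjective (v - z)
  have h1 := D₂.a_pos _ h.map_mem (v - z) (sub_ne_zero.2 hne)
  have h2 := hv y
  rw [hy] at h2
  rw [map_sub (D₂.a (φ x)), _root_.sub_apply, h2, sub_self] at h1
  exact lt_irrefl _ h1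

/-- Transformation law of the Levi-Civita connection: the difference of the two sides is symmetric
and skew with respect to the metric, hence zero. -/
lemma Γ_eq (ξ v : RSpace N) : fderiv ℝ φ x (D₁.Γ x ξ v) =
    D₂.Γ (φ x) (fderiv ℝ φ x ξ) (fderiv ℝ φ x v) + fderiv ℝ (fderiv ℝ φ) x ξ v := by
  set T := fderiv ℝ φ x with hT
  set S := fderiv ℝ (fderiv ℝ φ) x with hS
  have hSsymm : ∀ v z, S v z = S z v := fun v z =>
    (h.contDiffAt.isSymmSndFDerivAt 
      (by rw [minSmoothness_of_isRCLikeNormedField]; exact ENat.LEInfty.out)) v z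
  set Δ : RSpace N → RSpace N → RSpace N := fun ξ v =>
    T (D₁.Γ x ξ v) - (D₂.Γ (φ x) (T ξ) (T v) + S ξ v) with hΔ
  have hΔsymm : ∀ v z, Δ v z = Δ z v := fun v z => by
    simp only [hΔ, D₁.Γ_symm x h.mem v z, D₂.Γ_symm _ h.map_mem (T v), hSsymm v z]
  have hskew : ∀ ξ v z, D₂.a (φ x) (Δ ξ v) (T z) + D₂.a (φ x) (T v) (Δ ξ z) = 0 := by
    intro ξ v z
    have l := RSpace.hasDerivWithinAt_line x ξ Set.univ 0
    have e0 : x + (0 : ℝ) • ξ = x := by simp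
    have h1 := hasDerivWithinAt_a (D := D₁) (x := fun τ : ℝ => x + τ • ξ) (t := 0)
      (by simpa using h.mem) l (hasDerivWithinAt_const 0 Set.univ v)
      (hasDerivWithinAt_const 0 Set.univ z)
    have hφ : HasFDerivAt φ T (x + (0 : ℝ) • ξ) := by rw [e0]; exact h.hasFDerivAt
    have hφ' : HasFDerivAt (fderiv ℝ φ) S (x + (0 : ℝ) • ξ) := by
      rw [e0]; exact h.hasFDerivAt_fderiv
    have l1 := hφ.comp_hasDerivWithinAt (0 : ℝ) l
    have l2 : HasDerivWithinAt (fun τ : ℝ => fderiv ℝ φ (x + τ • ξ)) (S ξ) Set.univ 0 :=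
      HasFDerivAt.comp_hasDerivWithinAt (E := RSpace N →L[ℝ] RSpace N) (0 : ℝ) hφ' l
    have h2 := hasDerivWithinAt_a (D := D₂) (x := fun τ : ℝ => φ (x + τ • ξ)) (t := 0)
      (by simpa using h.map_mem) l1 (l2.clm_apply (hasDerivWithinAt_const 0 Set.univ v))
      (l2.clm_apply (hasDerivWithinAt_const 0 Set.univ z))
    have hev : (fun τ : ℝ => D₁.a (x + τ • ξ) v z) =ᶠ[nhds 0] fun τ : ℝ =>
        D₂.a (φ (x + τ • ξ)) (fderiv ℝ φ (x + τ • ξ) v) (fderiv ℝ φ (x + τ • ξ) z) := by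
      have hc : Filter.Tendsto (fun τ : ℝ => x + τ • ξ) (nhds 0) (nhds x) := by
        have : ContinuousAt (fun τ : ℝ => x + τ • ξ) 0 := by fun_prop
        simpa [ContinuousAt] using this
      filter_upwards [hc.eventually h.a_eq] with τ hτ using hτ v z
    have h3 := (hasDerivWithinAt_univ.1 h1).unique
      ((hasDerivWithinAt_univ.1 h2).congr_of_eventuallyEq hev)
    simp only [e0, zero_add, map_zero, add_zero, ← hT] at h3
    rw [h.a_eq.self_of_nhds, h.a_eq.self_of_nhds, ← hT] at h3
    simp only [hΔ, map_sub, map_add, _root_.sub_apply, _root_.add_apply] at h3 ⊢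
    linarith
  refine h.eq_of_forall_a_eq fun z => ?_
  have ha := D₂.a_symm _ h.map_mem
  have h1 := hskew ξ v z
  have h2 := hskew z ξ v
  have h3 := hskew v z ξ
  rw [ha (T v), hΔsymm ξ z] at h1
  rw [ha (T ξ), hΔsymm z v] at h2
  rw [ha (T z), hΔsymm v ξ] at h3
  have h4 : D₂.a (φ x) (Δ ξ v) (T z) = 0 := by linarith
  rw [hΔ] at h4
  simp only [map_sub, _root_.sub_apply] at h4
  exact sub_eq_zero.1 h4

lemma r_eq (v z : RSpace N) :
    D₁.r x v z = D₂.r (φ x) (fderiv ℝ φ x v) (fderiv ℝ φ x z) := by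
  rw [r, r, h.a_eq.self_of_nhds, h.b_eq, h.b_eq]

lemma q_eq (v : RSpace N) : D₁.q x v = D₂.q (φ x) (fderiv ℝ φ x v) := by
  rw [q, q, h.r_eq]

lemma w_eq : fderiv ℝ φ x (D₁.w x) = D₂.w (φ x) :=
  h.eq_of_forall_a_eq fun y => by
    rw [← h.a_eq.self_of_nhds, D₁.a_w _ h.mem, D₂.a_w _ h.map_mem, h.b_eq]

lemma conn_eq (y ξ : RSpace N) : fderiv ℝ φ x (D₁.conn x y ξ) =
    D₂.conn (φ x) (fderiv ℝ φ x y) (fderiv ℝ φ x ξ) + fderiv ℝ (fderiv ℝ φ) x ξ y := by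
  simp only [conn, map_add, map_smul, map_sub, h.Γ_eq, h.w_eq, h.r_eq, h.q_eq, h.b_eq, h.k_eq,
    h.g_eq]
  abel

/-- Parallelism of a vector field along a curve does not depend on the coordinates. -/
lemma hasDerivWithinAt_parallel {c y : ℝ → RSpace N} {ξ : RSpace N} {s : Set ℝ} {t : ℝ}
    (hx : c t = x) (hc : HasDerivWithinAt c ξ s t)
    (hy : HasDerivWithinAt y (-D₁.conn x (y t) ξ) s t) :
    HasDerivWithinAt (fun τ => fderiv ℝ φ (c τ) (y τ))
      (-D₂.conn (φ x) (fderiv ℝ φ x (y t)) (fderiv ℝ φ x ξ)) s t := by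
  subst hx
  have h1 : HasDerivWithinAt (fun τ => fderiv ℝ φ (c τ)) (fderiv ℝ (fderiv ℝ φ) (c t) ξ) s t :=
    HasFDerivAt.comp_hasDerivWithinAt (E := RSpace N →L[ℝ] RSpace N) t h.hasFDerivAt_fderiv hc
  refine (h1.clm_apply hy).congr_deriv ?_
  rw [map_neg, h.conn_eq]
  abel

end IsTransition

end LocalFinsleroid

namespace FinsleroidSpace

open RSpace

variable {N : ℕ} {M : Type*} [TopologicalSpace M] [ChartedSpace (RSpace N) M]
  [IsManifold 𝓘(ℝ, RSpace N) ∞ M] (F : FinsleroidSpace N M)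
  {e e₁ e₂ : OpenPartialHomeomorph M (RSpace N)}

section Transition

variable {k : M → ℝ}
  (hk : ∀ e ∈ IsManifold.maximalAtlas 𝓘(ℝ, RSpace N) ∞ M, ∀ u ∈ e.target, ∀ i j,
    F.nablaB e u i j = k (e.symm u) * (F.aCoord e u i j - F.bCoord e u i * F.bCoord e u j))

lemma isTransition (he₁ : e₁ ∈ IsManifold.maximalAtlas 𝓘(ℝ, RSpace N) ∞ M)
    (he₂ : e₂ ∈ IsManifold.maximalAtlas 𝓘(ℝ, RSpace N) ∞ M) {p : M}
    (hp₁ : p ∈ e₁.source) (hp₂ : p ∈ e₂.source) :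
    (F.localData he₁ k (hk e₁ he₁)).IsTransition (F.localData he₂ k (hk e₂ he₂))
      (e₂ ∘ e₁.symm) (e₁ p) := by
  have hu := e₁.map_source hp₁
  have hu' : e₁.symm (e₁ p) ∈ e₂.source := by rwa [e₁.left_inv hp₁]
  have hev : ∀ᶠ u in nhds (e₁ p), u ∈ e₁.target ∧ e₁.symm u ∈ e₂.source :=
    (e₁.open_target.eventually_mem hu).and
      ((e₁.continuousAt_symm hu).eventually (e₂.open_source.eventually_mem hu'))
  refine ⟨hu, e₂.map_source hu', ?_, ?_, ?_, ?_, ?_, rfl⟩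
  · have h1 := (contMDiffOn_symm_of_mem_maximalAtlas he₁).contMDiffAt
      (e₁.open_target.mem_nhds hu)
    have h2 := (contMDiffOn_of_mem_maximalAtlas he₂).contMDiffAt (e₂.open_source.mem_nhds hu')
    exact contMDiffAt_iff_contDiffAt.1 (h2.comp _ h1)
  · intro v
    obtain ⟨z, hz⟩ :=
      ((mdifferentiable_of_mem_maximalAtlas he₂).mfderiv_surjective hu') v
    obtain ⟨y, rfl⟩ := (ofCoord_bijective he₁ hu).2 z
    exact ⟨y, (toCoord_ofCoord he₁ he₂ hu hu' y).symm.trans hz⟩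
  · filter_upwards [hev] with u hu v z
    change F.a.inner (e₁.symm u) (ofCoord e₁ u v) (ofCoord e₁ u z) = F.aForm e₂ _ _ _
    rw [← toCoord_ofCoord he₁ he₂ hu.1 hu.2, ← toCoord_ofCoord he₁ he₂ hu.1 hu.2]
    exact (apply₂_ofCoord_toCoord (fun p y z => F.a.inner p y z) he₂ hu.2 _ _).symm
  · intro v
    change F.b (e₁.symm (e₁ p)) (ofCoord e₁ (e₁ p) v) = F.bForm e₂ _ _
    rw [← toCoord_ofCoord he₁ he₂ hu hu']
    exact (apply_ofCoord_toCoord (fun p y => F.b p y) he₂ hu' _).symm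
  · change k (e₁.symm (e₁ p)) = k (e₂.symm (e₂ (e₁.symm (e₁ p))))
    rw [e₂.left_inv hu']

end Transition

end FinsleroidSpace

/-! ### Parallel vector fields -/

namespace FinsleroidSpace

open RSpace

variable {N : ℕ} {M : Type*} [TopologicalSpace M] [ChartedSpace (RSpace N) M]
  [IsManifold 𝓘(ℝ, RSpace N) ∞ M] (F : FinsleroidSpace N M)
  {e e₁ e₂ : OpenPartialHomeomorph M (RSpace N)} {k : M → ℝ}
  (hk : ∀ e ∈ IsManifold.maximalAtlas 𝓘(ℝ, RSpace N) ∞ M, ∀ u ∈ e.target, ∀ i j,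
    F.nablaB e u i j = k (e.symm u) * (F.aCoord e u i j - F.bCoord e u i * F.bCoord e u j))

lemma q_localData_toCoord (he : e ∈ IsManifold.maximalAtlas 𝓘(ℝ, RSpace N) ∞ M) {p : M}
    (hp : p ∈ e.source) (y : TangentSpace 𝓘(ℝ, RSpace N) p) :
    (F.localData he k (hk e he)).q (e p) (toCoord e y) = F.q y :=
  apply_ofCoord_toCoord (fun _ y => F.q y) he hp y

lemma K_localData_toCoord (he : e ∈ IsManifold.maximalAtlas 𝓘(ℝ, RSpace N) ∞ M) {p : M}
    (hp : p ∈ e.source) (y : TangentSpace 𝓘(ℝ, RSpace N) p) :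
    (F.localData he k (hk e he)).K (e p) (toCoord e y) = F.K y :=
  apply_ofCoord_toCoord (fun _ y => F.K y) he hp y

lemma lam_localData_toCoord (he : e ∈ IsManifold.maximalAtlas 𝓘(ℝ, RSpace N) ∞ M) {p : M}
    (hp : p ∈ e.source) (y z : TangentSpace 𝓘(ℝ, RSpace N) p) :
    (F.localData he k (hk e he)).lam (e p) (toCoord e y) (toCoord e z) = F.lam y z :=
  apply₂_ofCoord_toCoord (fun _ y z => F.lam y z) he hp y z

include hk in
/-- By Euler's relations the absolute length is the metric function. -/
lemma absLength_eq {p : M} (y : TangentSpace 𝓘(ℝ, RSpace N) p) (hy : 0 < F.q y) :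
    F.absLength y = F.K y := by
  have he := IsManifold.chart_mem_maximalAtlas (I := 𝓘(ℝ, RSpace N)) (n := ∞) p
  have hp := mem_chart_source (RSpace N) p
  have hK := F.K_localData_toCoord hk he hp y
  have hq : 0 < (F.localData he k (hk _ he)).q (chartAt (RSpace N) p p)
      (toCoord (chartAt (RSpace N) p) y) := by rwa [F.q_localData_toCoord hk he hp]
  have h := LocalFinsleroid.sum_metricTensor_eq (D := F.localData he k (hk _ he))
    ((chartAt (RSpace N) p).map_source hp) hq
  rw [absLength, ← localData_K F he k (hk _ he)]
  dsimp only
  rw [h, hK, Real.sqrt_sq (by unfold K; positivity)]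

/-- In the chart of the definition, a parallel vector field satisfies the equation of parallel
transport of the local data. -/
lemma hasDerivWithinAt_of_sum_connection
    (he : e ∈ IsManifold.maximalAtlas 𝓘(ℝ, RSpace N) ∞ M) {I : Set ℝ} {c : ℝ → M}
    {Y : ∀ t : ℝ, TangentSpace 𝓘(ℝ, RSpace N) (c t)} {t : ℝ} (hs : c t ∈ e.source)
    (hq : 0 < F.q (Y t)) {ξ η : RSpace N}
    (hη : HasDerivWithinAt (fun s => (toCoord e (Y s) : RSpace N)) η I t)
    (h : ∀ i, η i + ∑ k, Finsler.connection (F.KCoord e) (e (c t)) (toCoord e (Y t)) i k * ξ k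
      = 0) :
    HasDerivWithinAt (fun s => (toCoord e (Y s) : RSpace N))
      (-(F.localData he k (hk e he)).conn (e (c t)) (toCoord e (Y t)) ξ) I t := by
  refine hη.congr_deriv ?_
  ext i
  have hq' : 0 < (F.localData he k (hk _ he)).q (e (c t)) (toCoord e (Y t)) := by
    rwa [F.q_localData_toCoord hk he hs]
  have h1 := h i
  rw [← localData_K F he k (hk _ he),
    LocalFinsleroid.sum_connection_eq (D := F.localData he k (hk _ he)) (e.map_source hs) hq'] at h1
  exact eq_neg_of_add_eq_zero_left h1

include hk in
lemma hasDerivWithinAt_K_of_isParallelAlong {I : Set ℝ} {c : ℝ → M}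
    {Y : ∀ t : ℝ, TangentSpace 𝓘(ℝ, RSpace N) (c t)} (hY : F.IsParallelAlong I c Y)
    (hq : ∀ t ∈ I, 0 < F.q (Y t)) {t : ℝ} (ht : t ∈ I) :
    HasDerivWithinAt (fun s => F.K (Y s)) 0 I t := by
  obtain ⟨e, he, hs, ξ, η, hξ, hη, h⟩ := hY.2 t ht
  have hy := F.hasDerivWithinAt_of_sum_connection hk he hs (hq t ht) hη h
  have hq' : 0 < (F.localData he k (hk _ he)).q (e (c t)) (toCoord e (Y t)) := by
    rw [F.q_localData_toCoord hk he hs]; exact hq t ht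
  have hK := LocalFinsleroid.hasDerivWithinAt_K_parallel (D := F.localData he k (hk _ he))
    (e.map_source hs) hξ hy hq'
  refine hK.congr_of_eventuallyEq ?_ (F.K_localData_toCoord hk he hs _).symm
  filter_upwards [(hY.1 t ht).eventually (e.open_source.eventually_mem hs)] with s hs'
    using (F.K_localData_toCoord hk he hs' _).symm

include hk in
/-- The two fields may be parallel with respect to different charts at the time `t`; the first one
is moved to the chart of the second. -/
lemma hasDerivWithinAt_lam_of_isParallelAlong {I : Set ℝ} {c : ℝ → M}
    {Y₁ Y₂ : ∀ t : ℝ, TangentSpace 𝓘(ℝ, RSpace N) (c t)} {t : ℝ} (hI : UniqueDiffWithinAt ℝ I t)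
    (hY₁ : F.IsParallelAlong I c Y₁) (hY₂ : F.IsParallelAlong I c Y₂)
    (hq₁ : ∀ t ∈ I, 0 < F.q (Y₁ t)) (hq₂ : ∀ t ∈ I, 0 < F.q (Y₂ t)) (ht : t ∈ I) :
    HasDerivWithinAt (fun s => F.lam (Y₁ s) (Y₂ s)) 0 I t := by
  obtain ⟨e₁, he₁, hs₁, ξ₁, η₁, hξ₁, hη₁, h₁⟩ := hY₁.2 t ht
  obtain ⟨e₂, he₂, hs₂, ξ₂, η₂, hξ₂, hη₂, h₂⟩ := hY₂.2 t ht
  have hy₁ := F.hasDerivWithinAt_of_sum_connection hk he₁ hs₁ (hq₁ t ht) hη₁ h₁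
  have hy₂ := F.hasDerivWithinAt_of_sum_connection hk he₂ hs₂ (hq₂ t ht) hη₂ h₂
  have htr := F.isTransition hk he₁ he₂ hs₁ hs₂
  have hev : ∀ᶠ s in nhdsWithin t I, c s ∈ e₁.source ∧ c s ∈ e₂.source :=
    ((hY₁.1 t ht).eventually (e₁.open_source.eventually_mem hs₁)).and
      ((hY₁.1 t ht).eventually (e₂.open_source.eventually_mem hs₂))
  have hφ : (e₂ ∘ e₁.symm) (e₁ (c t)) = e₂ (c t) := by simp [e₁.left_inv hs₁]
  have hξ : fderiv ℝ (e₂ ∘ e₁.symm) (e₁ (c t)) ξ₁ = ξ₂ := by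
    have h3 := htr.hasFDerivAt.comp_hasDerivWithinAt t hξ₁
    refine hI.eq_deriv _ (h3.congr_of_eventuallyEq ?_ ?_) hξ₂
    · filter_upwards [hev] with s hs
      simp [e₁.left_inv hs.1]
    · simp [e₁.left_inv hs₁]
  have hy₁' := htr.hasDerivWithinAt_parallel rfl hξ₁ hy₁
  rw [hξ, hφ, fderiv_transition_toCoord he₁ he₂ hs₁ hs₂] at hy₁'
  have hy₁'' : HasDerivWithinAt (fun s => (toCoord e₂ (Y₁ s) : RSpace N))
      (-(F.localData he₂ k (hk e₂ he₂)).conn (e₂ (c t)) (toCoord e₂ (Y₁ t)) ξ₂) I t := by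
    refine hy₁'.congr_of_eventuallyEq ?_ (fderiv_transition_toCoord he₁ he₂ hs₁ hs₂ _).symm
    filter_upwards [hev] with s hs using (fderiv_transition_toCoord he₁ he₂ hs.1 hs.2 _).symm
  have hl := LocalFinsleroid.hasDerivWithinAt_lam_parallel (D := F.localData he₂ k (hk _ he₂))
    (e₂.map_source hs₂) hξ₂ hy₁'' hy₂
    (by rw [F.q_localData_toCoord hk he₂ hs₂]; exact hq₁ t ht)
    (by rw [F.q_localData_toCoord hk he₂ hs₂]; exact hq₂ t ht)
  refine hl.congr_of_eventuallyEq ?_ (F.lam_localData_toCoord hk he₂ hs₂ _ _).symm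
  filter_upwards [hev] with s hs using (F.lam_localData_toCoord hk he₂ hs.2 _ _).symm

lemma eq_of_hasDerivWithinAt_zero {I : Set ℝ} (hI : I.OrdConnected) {f : ℝ → ℝ}
    (hf : ∀ t ∈ I, HasDerivWithinAt f 0 I t) {s t : ℝ} (hs : s ∈ I) (ht : t ∈ I) : f s = f t := by
  have := hI.convex.norm_image_sub_le_of_norm_hasDerivWithin_le (f' := fun _ => 0) (C := 0) hf
    (by simp) hs ht
  rw [zero_mul, norm_le_zero_iff, sub_eq_zero] at this
  exact this.symm

lemma uniqueDiffWithinAt_of_ne {I : Set ℝ} (hI : I.OrdConnected) {s t r : ℝ} (hs : s ∈ I)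
    (ht : t ∈ I) (hst : s ≠ t) (hr : r ∈ I) : UniqueDiffWithinAt ℝ I r := by
  refine uniqueDiffWithinAt_convex hI.convex ?_ (subset_closure hr)
  have h1 : Set.Ioo (min s t) (max s t) ⊆ interior I :=
    interior_maximal (Set.Ioo_subset_Icc_self.trans (hI.uIcc_subset hs ht)) isOpen_Ioo
  exact (Set.nonempty_Ioo.2 (min_lt_max.2 hst)).mono h1

end FinsleroidSpace

theorem mainTheorem1 {N : ℕ} {M : Type*} [TopologicalSpace M] [ChartedSpace (RSpace N) M]
    [IsManifold 𝓘(ℝ, RSpace N) ∞ M] (F : FinsleroidSpace N M) (hF : F.IsLandsbergCase) :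
    (∀ e ∈ IsManifold.maximalAtlas 𝓘(ℝ, RSpace N) ∞ M, ∀ x ∈ e.target, ∀ y₁ y₂ : RSpace N,
      0 < F.q (FinsleroidSpace.ofCoord e x y₁) → 0 < F.q (FinsleroidSpace.ofCoord e x y₂) →
      F.lam (FinsleroidSpace.ofCoord e x y₁) (FinsleroidSpace.ofCoord e x y₂) ≠ -1 →
      DifferentiableAt ℝ
        (fun z : RSpace N × RSpace N × RSpace N => F.scalarProductCoord e z.1 z.2.1 z.2.2)
        (x, y₁, y₂) ∧
      ∀ k : Fin N,
        partialDeriv k (fun u => F.scalarProductCoord e u y₁ y₂) x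
          - ∑ n, Finsler.connection (F.KCoord e) x y₁ n k *
              partialDeriv n (fun v => F.scalarProductCoord e x v y₂) y₁
          - ∑ n, Finsler.connection (F.KCoord e) x y₂ n k *
              partialDeriv n (fun v => F.scalarProductCoord e x y₁ v) y₂ = 0) ∧
    (∀ (I : Set ℝ) (c : ℝ → M) (Y₁ Y₂ : ∀ t : ℝ, TangentSpace 𝓘(ℝ, RSpace N) (c t)),
      I.OrdConnected →
      F.IsParallelAlong I c Y₁ → F.IsParallelAlong I c Y₂ →
      (∀ t ∈ I, 0 < F.q (Y₁ t)) → (∀ t ∈ I, 0 < F.q (Y₂ t)) →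
      ∀ s ∈ I, ∀ t ∈ I,
        F.scalarProduct (Y₁ s) (Y₂ s) = F.scalarProduct (Y₁ t) (Y₂ t) ∧
        F.angle (Y₁ s) (Y₂ s) = F.angle (Y₁ t) (Y₂ t) ∧
        F.absAngle (Y₁ s) (Y₂ s) = F.absAngle (Y₁ t) (Y₂ t)) := by
  obtain ⟨k, hk⟩ := hF
  refine ⟨fun e he x hx y₁ y₂ hq₁ hq₂ hlam => ⟨?_, fun i => ?_⟩,
    fun I c Y₁ Y₂ hI hY₁ hY₂ hq₁ hq₂ s hs t ht => ?_⟩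
  · exact LocalFinsleroid.differentiableAt_scalarProduct (D := F.localData he k (hk e he))
      (z := (x, y₁, y₂)) hx hq₁ hq₂ hlam
  · exact LocalFinsleroid.horizontal_scalarProduct (D := F.localData he k (hk e he))
      hx hq₁ hq₂ hlam i
  · have hK₁ : F.K (Y₁ s) = F.K (Y₁ t) := FinsleroidSpace.eq_of_hasDerivWithinAt_zero hI
      (fun r hr => F.hasDerivWithinAt_K_of_isParallelAlong hk hY₁ hq₁ hr) hs ht
    have hK₂ : F.K (Y₂ s) = F.K (Y₂ t) := FinsleroidSpace.eq_of_hasDerivWithinAt_zero hI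
      (fun r hr => F.hasDerivWithinAt_K_of_isParallelAlong hk hY₂ hq₂ hr) hs ht
    have hlam : F.lam (Y₁ s) (Y₂ s) = F.lam (Y₁ t) (Y₂ t) := by
      -- on a one-point interval velocities are not unique, but there is nothing to prove
      rcases eq_or_ne s t with rfl | hst
      · rfl
      exact FinsleroidSpace.eq_of_hasDerivWithinAt_zero (f := fun r => F.lam (Y₁ r) (Y₂ r)) hI
        (fun r hr => F.hasDerivWithinAt_lam_of_isParallelAlong hk
          (FinsleroidSpace.uniqueDiffWithinAt_of_ne hI hs ht hst hr) hY₁ hY₂ hq₁ hq₂ hr) hs ht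
    have hangle : F.angle (Y₁ s) (Y₂ s) = F.angle (Y₁ t) (Y₂ t) := by
      rw [FinsleroidSpace.angle, hlam, FinsleroidSpace.angle]
    have hsp : F.scalarProduct (Y₁ s) (Y₂ s) = F.scalarProduct (Y₁ t) (Y₂ t) := by
      rw [FinsleroidSpace.scalarProduct, hK₁, hK₂, hangle, FinsleroidSpace.scalarProduct]
    refine ⟨hsp, hangle, ?_⟩
    rw [FinsleroidSpace.absAngle, FinsleroidSpace.absAngle, hsp,
      F.absLength_eq hk _ (hq₁ s hs), F.absLength_eq hk _ (hq₂ s hs),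
      F.absLength_eq hk _ (hq₁ t ht), F.absLength_eq hk _ (hq₂ t ht), hK₁, hK₂]
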